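/- Let $\Bbbk$ be a field and let $(X,\mathcal O_X)$ be a ringed space such that $\mathcal O_X$ is a sheaf of commutative $\Bbbk$-algebras. Let $\mathscr M_1,\mathscr M_2$ be $\mathcal O_X$-modules that are locally free of finite rank. Let $\mathscr MQ = T_{\mathcal O_X}(\mathscr M_1\oplus\mathscr M_2)$ be the tensor algebra over $\mathcal O_X$, that is, the twisted quiver algebra, with twists $\mathscr M_1,\mathscr M_2$, of the doubled Jordan quiver $Q$ (one vertex, two loops). Let $\mathscr K\subset\mathscr MQ$ be the sheaf of two-sided ideals generated by the commutators $[m_1,m_2]=m_1m_2-m_2m_1$, where $m_1,m_2$ are local sections of $\mathscr M_1,\mathscr M_2$ over the same open set, and for $p\ge 0$ let $\mathscr K^p$ be its $p$-th power as a sheaf of ideals, with $\mathscr K^0=\mathscr MQ$. Then: (K1) for every $p\ge 0$ the $\mathcal O_X$-module $\mathscr K^p/\mathscr K^{p+1}$ is locally free (possibly of infinite rank); (K2) $\mathscr K$ is flat as a right $\mathscr MQ$-module, i.e. the functor $\mathscr K\otimes_{\mathscr MQ}-$ from sheaves of left $\mathscr MQ$-modules to sheaves of abelian groups is exact. -/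

import Mathlib

open CategoryTheory TopologicalSpace Opposite Limits AlgebraicGeometry
open scoped TensorProduct

universe u

noncomputable section

namespace TwistedQuiver

/-! ### The sheaf of rings `T_𝒪(M)` -/

/-- The ring homomorphism between tensor algebras induced by a semilinear map. -/
def tensorAlgebraMap {R S M N : Type u} [CommRing R] [CommRing S] [AddCommGroup M] [AddCommGroup N]
    [Module R M] [Module S N] (σ : R →+* S) (f : M →ₛₗ[σ] N) :
    TensorAlgebra R M →+* TensorAlgebra S N :=
  letI : Algebra R (TensorAlgebra S N) :=
    ((algebraMap S (TensorAlgebra S N)).comp σ).toAlgebra' fun r x =>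
      Algebra.commutes (σ r) x
  (TensorAlgebra.lift R
    ({ toFun := fun m => TensorAlgebra.ι S (f m)
       map_add' := fun a b => by simp
       map_smul' := fun r m => by
         rw [map_smulₛₗ, map_smul, Algebra.smul_def, RingHom.id_apply, Algebra.smul_def]
         rfl } : M →ₗ[R] TensorAlgebra S N)).toRingHom

section
variable {R S M N : Type u} [CommRing R] [CommRing S] [AddCommGroup M] [AddCommGroup N]
    [Module R M] [Module S N] (σ : R →+* S) (f : M →ₛₗ[σ] N)

@[simp] lemma tensorAlgebraMap_ι (m : M) :
    tensorAlgebraMap σ f (TensorAlgebra.ι R m) = TensorAlgebra.ι S (f m) := by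
  let : Algebra R (TensorAlgebra S N) :=
    ((algebraMap S (TensorAlgebra S N)).comp σ).toAlgebra' fun r x =>
      Algebra.commutes (σ r) x
  exact TensorAlgebra.lift_ι_apply _ _

@[simp] lemma tensorAlgebraMap_algebraMap (r : R) :
    tensorAlgebraMap σ f (algebraMap R _ r) = algebraMap S _ (σ r) := by
  let : Algebra R (TensorAlgebra S N) :=
    ((algebraMap S (TensorAlgebra S N)).comp σ).toAlgebra' fun r x =>
      Algebra.commutes (σ r) x
  exact AlgHom.commutes (TensorAlgebra.lift R _) r

/-- Two ring homomorphisms out of a tensor algebra agree if they do on scalars and vectors. -/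
lemma tensorAlgebra_ringHom_ext {A : Type u} [Ring A] {g h : TensorAlgebra R M →+* A}
    (h₁ : ∀ r, g (algebraMap R _ r) = h (algebraMap R _ r))
    (h₂ : ∀ m, g (TensorAlgebra.ι R m) = h (TensorAlgebra.ι R m)) : g = h := by
  ext x
  induction x using TensorAlgebra.induction with
  | algebraMap r => exact h₁ r
  | ι m => exact h₂ m
  | mul a b ha hb => rw [map_mul, map_mul, ha, hb]
  | add a b ha hb => rw [map_add, map_add, ha, hb]
end

/-- The presheaf of rings `U ↦ T_{𝒪(U)}(M(U))`. -/
def tensorAlgebraPresheaf {C : Type u} [Category.{u} C] {O : Cᵒᵖ ⥤ CommRingCat.{u}}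
    (M : PresheafOfModules.{u} (O ⋙ forget₂ CommRingCat RingCat)) : Cᵒᵖ ⥤ RingCat.{u} where
  obj U := RingCat.of (TensorAlgebra (O.obj U) (M.obj U))
  map {U V} i := RingCat.ofHom (tensorAlgebraMap (O.map i).hom (M.restrictₛₗ i))
  map_id U := by
    ext1
    refine tensorAlgebra_ringHom_ext (fun r => ?_) (fun m => ?_)
    · simp
    · simp only [tensorAlgebraMap_ι, RingCat.hom_ofHom, RingCat.hom_id, RingHom.id_apply]
      refine congrArg _ ?_
      change M.map (𝟙 U) m = m
      rw [M.map_id]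
      rfl
  map_comp {U V W} i j := by
    ext1
    refine tensorAlgebra_ringHom_ext (fun r => ?_) (fun m => ?_)
    · simp
    · simp only [tensorAlgebraMap_ι, RingCat.hom_ofHom, RingCat.hom_comp, RingHom.comp_apply]
      exact congrArg _ (M.map_comp_apply i j m)


/-- The inclusion of scalars `𝒪(U) → T_{𝒪(U)}(M(U))`. -/
def tensorAlgebraPresheafUnit {C : Type u} [Category.{u} C] {O : Cᵒᵖ ⥤ CommRingCat.{u}}
    (M : PresheafOfModules.{u} (O ⋙ forget₂ CommRingCat RingCat)) :
    O ⋙ forget₂ CommRingCat RingCat ⟶ tensorAlgebraPresheaf M where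
  app U := RingCat.ofHom (algebraMap (O.obj U) (TensorAlgebra (O.obj U) (M.obj U)))
  naturality U V i := by
    ext r
    exact (tensorAlgebraMap_algebraMap (O.map i).hom (M.restrictₛₗ i) r).symm

/-- The inclusion of vectors `M(U) → T_{𝒪(U)}(M(U))`. -/
def tensorAlgebraPresheafι {C : Type u} [Category.{u} C] {O : Cᵒᵖ ⥤ CommRingCat.{u}}
    (M : PresheafOfModules.{u} (O ⋙ forget₂ CommRingCat RingCat)) (U : Cᵒᵖ) (m : M.obj U) :
    (tensorAlgebraPresheaf M).obj U :=
  TensorAlgebra.ι (O.obj U) (M := M.obj U) m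

/-! ### Sheaves of rings, opposite rings, two-sided ideals -/

section Sheaves

variable {X : TopCat.{u}}

/-- Restriction of sections of a sheaf of rings. -/
def res (S : Sheaf (Opens.grothendieckTopology X) RingCat.{u}) {U V : Opens X} (h : V ≤ U) :
    S.obj.obj (op U) →+* S.obj.obj (op V) :=
  (S.obj.map (homOfLE h).op).hom

/-- A sheaf of two-sided ideals in a sheaf of rings. -/
structure IdealSheaf (S : Sheaf (Opens.grothendieckTopology X) RingCat.{u}) where
  /-- the sections over `U` -/
  obj (U : Opens X) : TwoSidedIdeal (S.obj.obj (op U))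
  res_mem {U V : Opens X} (h : V ≤ U) {s : S.obj.obj (op U)} (hs : s ∈ obj U) :
    res S h s ∈ obj V
  of_local (U : Opens X) (s : S.obj.obj (op U))
    (hs : ∀ x ∈ U, ∃ (V : Opens X) (h : V ≤ U), x ∈ V ∧ res S h s ∈ obj V) : s ∈ obj U

namespace IdealSheaf

variable {S : Sheaf (Opens.grothendieckTopology X) RingCat.{u}}

/-- The sheaf of two-sided ideals generated by a family `G` of local sections: the intersection of
all sheaves of two-sided ideals that contain `G`. -/
def generate (G : ∀ U : Opens X, Set (S.obj.obj (op U))) : IdealSheaf S where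
  obj U := ⨅ I : {I : IdealSheaf S // ∀ V, ∀ s ∈ G V, s ∈ I.obj V}, I.1.obj U
  res_mem h s hs := by
    rw [TwoSidedIdeal.mem_iInf] at hs ⊢
    exact fun I => I.1.res_mem h (hs I)
  of_local U s hs := by
    rw [TwoSidedIdeal.mem_iInf]
    intro I
    refine I.1.of_local U s fun x hx => ?_
    obtain ⟨V, h, hxV, hV⟩ := hs x hx
    rw [TwoSidedIdeal.mem_iInf] at hV
    exact ⟨V, h, hxV, hV I⟩

lemma mem_generate {G : ∀ U : Opens X, Set (S.obj.obj (op U))} {U : Opens X}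
    {s : S.obj.obj (op U)} :
    s ∈ (generate G).obj U ↔
      ∀ I : IdealSheaf S, (∀ V, ∀ t ∈ G V, t ∈ I.obj V) → s ∈ I.obj U := by
  simp [generate, TwoSidedIdeal.mem_iInf]

/-- The power `K ^ p`: the sheaf of two-sided ideals generated by the products `s₁ ⋯ s_p` of
sections of `K`; for `p = 0` this is the whole sheaf of rings. -/
def pow (K : IdealSheaf S) (p : ℕ) : IdealSheaf S :=
  generate fun U => {s | ∃ l : List (S.obj.obj (op U)), l.length = p ∧ (∀ a ∈ l, a ∈ K.obj U) ∧
    s = l.prod}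

lemma pow_succ_le (K : IdealSheaf S) (p : ℕ) (U : Opens X) {s : S.obj.obj (op U)}
    (hs : s ∈ (K.pow (p + 1)).obj U) : s ∈ (K.pow p).obj U := by
  refine mem_generate.1 hs (K.pow p) ?_
  rintro V t ⟨l, hl, hK, rfl⟩
  cases l with
  | nil => simp at hl
  | cons a l =>
    rw [List.prod_cons]
    refine (K.pow p).obj V |>.mul_mem_left _ _ (mem_generate.2 fun I hI => hI V _ ⟨l, ?_, ?_, rfl⟩)
    · simpa using hl
    · exact fun b hb => hK b (List.mem_cons_of_mem _ hb)

end IdealSheaf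

/-- A submodule of a sheaf of modules which is stable under gluing is a sheaf. -/
lemma isSheaf_submodule {R : Sheaf (Opens.grothendieckTopology X) RingCat.{u}}
    (M : SheafOfModules.{u} R) (N : M.val.Submodule)
    (hN : ∀ (U : Opens X) (s : M.val.obj (op U)),
      (∀ x ∈ U, ∃ (V : Opens X) (h : V ≤ U), x ∈ V ∧
        M.val.restrictₛₗ (homOfLE h).op s ∈ N.obj (op V)) → s ∈ N.obj (op U)) :
    Presheaf.IsSheaf (Opens.grothendieckTopology X) N.toPresheafOfModules.presheaf := by
  refine (TopCat.Presheaf.isSheaf_iff_isSheafUniqueGluing.{u} (X := X)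
    (N.toPresheafOfModules.presheaf : TopCat.Presheaf AddCommGrpCat.{u} X)).2 ?_
  intro ι W sf hsf
  have hM := (TopCat.Presheaf.isSheaf_iff_isSheafUniqueGluing.{u} (X := X)
    (M.val.presheaf : TopCat.Presheaf AddCommGrpCat.{u} X)).1 M.isSheaf
  obtain ⟨s, hs, huniq⟩ := hM W (fun i => (sf i).1) (fun i j => congrArg Subtype.val (hsf i j))
  refine ⟨⟨s, hN _ s ?_⟩, fun i => Subtype.ext (hs i), fun t ht =>
    Subtype.ext (huniq t.1 fun i => congrArg Subtype.val (ht i))⟩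
  intro x hx
  obtain ⟨i, hi⟩ := Opens.mem_iSup.1 hx
  refine ⟨W i, le_iSup W i, hi, ?_⟩
  have : M.val.restrictₛₗ (homOfLE (le_iSup W i)).op s = (sf i).1 := hs i
  rw [this]
  exact (sf i).2

namespace IdealSheaf

variable {S : Sheaf (Opens.grothendieckTopology X) RingCat.{u}}

/-- A sheaf of two-sided ideals of `S`, seen as a submodule of `S` over a sheaf of rings `R`
with a morphism `R ⟶ S`. -/
def submodule (I : IdealSheaf S) {R : Sheaf (Opens.grothendieckTopology X) RingCat.{u}}
    (α : R ⟶ S) :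
    ((SheafOfModules.restrictScalars α).obj (SheafOfModules.unit S)).val.Submodule where
  obj U :=
    { carrier := {s | (show S.obj.obj U from s) ∈ I.obj U.unop}
      add_mem' := fun {_ _} ha hb => (I.obj U.unop).add_mem ha hb
      zero_mem' := (I.obj U.unop).zero_mem
      smul_mem' := fun r _ hs => (I.obj U.unop).mul_mem_left ((α.hom.app U).hom r) _ hs }
  map {_ _} f _ hs := I.res_mem f.unop.le hs

/-- A sheaf of two-sided ideals of `S` as a sheaf of left `R`-modules, through `R ⟶ S`. -/
def toModule (I : IdealSheaf S) {R : Sheaf (Opens.grothendieckTopology X) RingCat.{u}}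
    (α : R ⟶ S) : SheafOfModules.{u} R where
  val := (I.submodule α).toPresheafOfModules
  isSheaf := isSheaf_submodule _ _ fun U s hs => I.of_local U s hs

/-- The inclusion `K ^ (p + 1) ⟶ K ^ p`. -/
def powInclusion (K : IdealSheaf S) {R : Sheaf (Opens.grothendieckTopology X) RingCat.{u}}
    (α : R ⟶ S) (p : ℕ) : (K.pow (p + 1)).toModule α ⟶ (K.pow p).toModule α where
  val := PresheafOfModules.Submodule.homOfLE
    (N₁ := (K.pow (p + 1)).submodule α) (N₂ := (K.pow p).submodule α)
    fun U _ hs => K.pow_succ_le p U.unop hs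

/-- The sheaf of left `R`-modules `K ^ p / K ^ (p + 1)`, through `R ⟶ S`. -/
def graded (K : IdealSheaf S) {R : Sheaf (Opens.grothendieckTopology X) RingCat.{u}}
    (α : R ⟶ S) (p : ℕ) : SheafOfModules.{u} R :=
  cokernel (K.powInclusion α p)

end IdealSheaf

/-! ### Right modules, tensor products and flatness -/

/-- The functor that sends a ring to the opposite ring. -/
def opRing : RingCat.{u} ⥤ RingCat.{u} where
  obj R := RingCat.of Rᵐᵒᵖ
  map f := RingCat.ofHom f.hom.op

/-- The sheaf of opposite rings. Sheaves of left modules over it are the sheaves of right modules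
over `S`. -/
def opSheaf (S : Sheaf (Opens.grothendieckTopology X) RingCat.{u}) :
    Sheaf (Opens.grothendieckTopology X) RingCat.{u} where
  obj := S.obj ⋙ opRing
  property := by
    have h := (TopCat.Presheaf.isSheaf_iff_isSheafUniqueGluing.{u} (X := X)
      (S.obj : TopCat.Presheaf RingCat.{u} X)).1 S.property
    refine (TopCat.Presheaf.isSheaf_iff_isSheafUniqueGluing.{u} (X := X)
      (S.obj ⋙ opRing : TopCat.Presheaf RingCat.{u} X)).2 ?_
    intro ι W sf hsf
    obtain ⟨s, hs, huniq⟩ := h W (fun i => MulOpposite.unop (sf i))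
      (fun i j => congrArg MulOpposite.unop (hsf i j))
    exact ⟨MulOpposite.op s, fun i => congrArg MulOpposite.op (hs i), fun t ht =>
      congrArg MulOpposite.op (huniq (MulOpposite.unop t)
        fun i => congrArg MulOpposite.unop (ht i))⟩

/-- A sheaf of two-sided ideals of `S` as a submodule of the sheaf of right modules `S`. -/
def IdealSheaf.rightSubmodule {S : Sheaf (Opens.grothendieckTopology X) RingCat.{u}}
    (I : IdealSheaf S) : (SheafOfModules.unit (opSheaf S)).val.Submodule where
  obj U :=
    { carrier := {s | MulOpposite.unop (show (S.obj.obj U)ᵐᵒᵖ from s) ∈ I.obj U.unop}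
      add_mem' := fun {_ _} ha hb => (I.obj U.unop).add_mem ha hb
      zero_mem' := (I.obj U.unop).zero_mem
      smul_mem' := fun r _ hs =>
        (I.obj U.unop).mul_mem_right _ (MulOpposite.unop (show (S.obj.obj U)ᵐᵒᵖ from r)) hs }
  map {_ _} f _ hs := I.res_mem f.unop.le hs

/-- A sheaf of two-sided ideals of `S` as a sheaf of right `S`-modules. -/
def IdealSheaf.toRightModule {S : Sheaf (Opens.grothendieckTopology X) RingCat.{u}}
    (I : IdealSheaf S) : SheafOfModules.{u} (opSheaf S) where
  val := I.rightSubmodule.toPresheafOfModules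
  isSheaf := isSheaf_submodule _ _ fun U s hs =>
    I.of_local U (MulOpposite.unop (show (S.obj.obj (op U))ᵐᵒᵖ from s)) hs

end Sheaves

section Tensor

/-- The relations `n r ⊗ l = n ⊗ r l` that define the tensor product over a ring `R` that need not
be commutative. -/
def balancedRel (R N L : Type u) [Ring R] [AddCommGroup N] [Module Rᵐᵒᵖ N]
    [AddCommGroup L] [Module R L] : AddSubgroup (N ⊗[ℤ] L) :=
  AddSubgroup.closure {z | ∃ (r : R) (n : N) (l : L),
    z = (MulOpposite.op r • n) ⊗ₜ[ℤ] l - n ⊗ₜ[ℤ] (r • l)}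

/-- The tensor product `N ⊗_R L` of a right module `N` and a left module `L` over a ring `R` that
need not be commutative. -/
abbrev BalancedTensor (R N L : Type u) [Ring R] [AddCommGroup N] [Module Rᵐᵒᵖ N]
    [AddCommGroup L] [Module R L] : Type u :=
  (N ⊗[ℤ] L) ⧸ balancedRel R N L

/-- The element `n ⊗ l` of `N ⊗_R L`. -/
def BalancedTensor.tmul (R : Type u) {N L : Type u} [Ring R] [AddCommGroup N] [Module Rᵐᵒᵖ N]
    [AddCommGroup L] [Module R L] (n : N) (l : L) : BalancedTensor R N L :=
  QuotientAddGroup.mk (n ⊗ₜ[ℤ] l)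

/-- The map `f ⊗ g`, for `f` and `g` semilinear along a ring homomorphism `σ`. -/
def BalancedTensor.map {R R' N N' L L' : Type u} [Ring R] [Ring R']
    [AddCommGroup N] [Module Rᵐᵒᵖ N] [AddCommGroup L] [Module R L]
    [AddCommGroup N'] [Module R'ᵐᵒᵖ N'] [AddCommGroup L'] [Module R' L'] (σ : R →+* R')
    (f : N →ₛₗ[σ.op] N') (g : L →ₛₗ[σ] L') :
    BalancedTensor R N L →+ BalancedTensor R' N' L' :=
  QuotientAddGroup.map (balancedRel R N L) (balancedRel R' N' L')
    (TensorProduct.map f.toAddMonoidHom.toIntLinearMap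
      g.toAddMonoidHom.toIntLinearMap).toAddMonoidHom (by
      rw [balancedRel, AddSubgroup.closure_le]
      rintro _ ⟨r, n, l, rfl⟩
      refine AddSubgroup.subset_closure ⟨σ r, f n, g l, ?_⟩
      simp)

lemma BalancedTensor.map_tmul {R R' N N' L L' : Type u} [Ring R] [Ring R']
    [AddCommGroup N] [Module Rᵐᵒᵖ N] [AddCommGroup L] [Module R L]
    [AddCommGroup N'] [Module R'ᵐᵒᵖ N'] [AddCommGroup L'] [Module R' L'] (σ : R →+* R')
    (f : N →ₛₗ[σ.op] N') (g : L →ₛₗ[σ] L') (n : N) (l : L) :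
    BalancedTensor.map σ f g (BalancedTensor.tmul R n l) =
      BalancedTensor.tmul R' (f n) (g l) := rfl

lemma BalancedTensor.hom_ext {R N L A : Type u} [Ring R] [AddCommGroup N] [Module Rᵐᵒᵖ N]
    [AddCommGroup L] [Module R L] [AddCommGroup A] {f g : BalancedTensor R N L →+ A}
    (h : ∀ n l, f (BalancedTensor.tmul R n l) = g (BalancedTensor.tmul R n l)) : f = g := by
  refine AddMonoidHom.ext fun x => ?_
  obtain ⟨y, rfl⟩ := QuotientAddGroup.mk_surjective x
  induction y using TensorProduct.induction_on with
  | zero => exact (map_zero f).trans (map_zero g).symm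
  | tmul n l => exact h n l
  | add a b ha hb => rw [QuotientAddGroup.mk_add, map_add, map_add, ha, hb]

lemma restrict_id {C : Type u} [Category.{u} C] {R : Cᵒᵖ ⥤ RingCat.{u}}
    (M : PresheafOfModules.{u} R) (U : Cᵒᵖ) (m : M.obj U) : M.restrictₛₗ (𝟙 U) m = m := by
  change M.map (𝟙 U) m = m
  rw [M.map_id]
  rfl

lemma restrict_comp {C : Type u} [Category.{u} C] {R : Cᵒᵖ ⥤ RingCat.{u}}
    (M : PresheafOfModules.{u} R) {U V W : Cᵒᵖ} (i : U ⟶ V) (j : V ⟶ W) (m : M.obj U) :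
    M.restrictₛₗ (i ≫ j) m = M.restrictₛₗ j (M.restrictₛₗ i m) :=
  M.map_comp_apply i j m

variable {X : TopCat.{u}} {S : Sheaf (Opens.grothendieckTopology X) RingCat.{u}}

instance (N : SheafOfModules.{u} (opSheaf S)) (U : (Opens X)ᵒᵖ) :
    Module (S.obj.obj U)ᵐᵒᵖ (N.val.obj U) :=
  inferInstanceAs (Module ((opSheaf S).obj.obj U) (N.val.obj U))

/-- The presheaf `U ↦ N(U) ⊗_{S(U)} L(U)`. -/
def tensorPresheaf (N : SheafOfModules.{u} (opSheaf S)) (L : SheafOfModules.{u} S) :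
    (Opens X)ᵒᵖ ⥤ AddCommGrpCat.{u} where
  obj U := AddCommGrpCat.of (BalancedTensor (S.obj.obj U) (N.val.obj U) (L.val.obj U))
  map i := AddCommGrpCat.ofHom
    (BalancedTensor.map (S.obj.map i).hom (N.val.restrictₛₗ i) (L.val.restrictₛₗ i))
  map_id U := by
    ext1
    refine BalancedTensor.hom_ext fun n l => ?_
    exact congrArg₂ (BalancedTensor.tmul (S.obj.obj U)) (restrict_id N.val U n)
      (restrict_id L.val U l)
  map_comp {U V W} i j := by
    ext1
    refine BalancedTensor.hom_ext fun n l => ?_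
    exact congrArg₂ (BalancedTensor.tmul (S.obj.obj W)) (restrict_comp N.val i j n)
      (restrict_comp L.val i j l)

/-- The presheaf map `N ⊗ L ⟶ N ⊗ L'` induced by `L ⟶ L'`. -/
def tensorPresheafMap (N : SheafOfModules.{u} (opSheaf S)) {L L' : SheafOfModules.{u} S}
    (φ : L ⟶ L') : tensorPresheaf N L ⟶ tensorPresheaf N L' where
  app U := AddCommGrpCat.ofHom
    (BalancedTensor.map (RingHom.id _) LinearMap.id (φ.val.app U).hom)
  naturality U V i := by
    ext1
    refine BalancedTensor.hom_ext fun n l => ?_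
    exact congrArg (BalancedTensor.tmul (S.obj.obj V) (N.val.restrictₛₗ i n))
      (PresheafOfModules.naturality_apply φ.val i l)

/-- The functor `N ⊗_S -` from sheaves of left `S`-modules to sheaves of abelian groups. -/
def tensorFunctor (N : SheafOfModules.{u} (opSheaf S)) :
    SheafOfModules.{u} S ⥤ Sheaf (Opens.grothendieckTopology X) AddCommGrpCat.{u} where
  obj L := (presheafToSheaf _ _).obj (tensorPresheaf N L)
  map φ := (presheafToSheaf _ _).map (tensorPresheafMap N φ)
  map_id L := by
    have h : tensorPresheafMap N (𝟙 L) = 𝟙 (tensorPresheaf N L) := by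
      ext U : 2
      ext1
      exact BalancedTensor.hom_ext fun n l => rfl
    rw [h]
    exact CategoryTheory.Functor.map_id _ _
  map_comp φ ψ := by
    have h : tensorPresheafMap N (φ ≫ ψ) = tensorPresheafMap N φ ≫ tensorPresheafMap N ψ := by
      ext U : 2
      ext1
      exact BalancedTensor.hom_ext fun n l => rfl
    rw [h]
    exact CategoryTheory.Functor.map_comp _ _ _

/-- A sheaf `N` of right `S`-modules is flat if `N ⊗_S -` preserves monomorphisms. -/
def IsFlatRight (N : SheafOfModules.{u} (opSheaf S)) : Prop :=
  (tensorFunctor N).PreservesMonomorphisms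

end Tensor

/-! ### The doubled Jordan quiver with relations -/

section Jordan

variable (X : RingedSpace.{u, u})

/-- The structure sheaf of a ringed space, as a sheaf of rings. -/
def structureSheaf : Sheaf (Opens.grothendieckTopology X.carrier) RingCat.{u} where
  obj := X.presheaf ⋙ forget₂ CommRingCat RingCat
  property := ((sheafCompose (Opens.grothendieckTopology X.carrier)
    (forget₂ CommRingCat RingCat)).obj X.sheaf).property

variable {X}

/-- A sheaf of `𝒪_X`-modules is locally free of finite rank if `X` is covered by open sets on each
of which it is free on a finite family of sections. -/
def IsLocallyFreeOfFiniteRank (M : SheafOfModules.{u} (structureSheaf X)) : Prop :=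
  ∃ q : SheafOfModules.LocalGeneratorsData.{u} M, q.IsLocallyFreeData ∧ q.IsFiniteType

/-- The tensor algebra `T_{𝒪_X}(M)`: the sheaf of rings associated to
`U ↦ T_{𝒪_X(U)}(M(U))`. -/
def tensorAlgebra (M : SheafOfModules.{u} (structureSheaf X)) :
    Sheaf (Opens.grothendieckTopology X.carrier) RingCat.{u} :=
  (presheafToSheaf _ _).obj (tensorAlgebraPresheaf (O := X.presheaf) M.val)

/-- The structure morphism `𝒪_X ⟶ T_{𝒪_X}(M)`. -/
def tensorAlgebraUnit (M : SheafOfModules.{u} (structureSheaf X)) :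
    structureSheaf X ⟶ tensorAlgebra M where
  hom := tensorAlgebraPresheafUnit (O := X.presheaf) M.val ≫
    toSheafify _ (tensorAlgebraPresheaf (O := X.presheaf) M.val)

/-- The section of `T_{𝒪_X}(M)` over `U` given by a section of `M` over `U`. -/
def tensorAlgebraι (M : SheafOfModules.{u} (structureSheaf X)) (U : Opens X.carrier)
    (m : M.val.obj (op U)) : (tensorAlgebra M).obj.obj (op U) :=
  ((toSheafify (Opens.grothendieckTopology X.carrier)
    (tensorAlgebraPresheaf (O := X.presheaf) M.val)).app (op U)).hom
      (tensorAlgebraPresheafι (O := X.presheaf) M.val (op U) m)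

variable (M₁ M₂ : SheafOfModules.{u} (structureSheaf X))

/-- The twisted quiver algebra of the doubled Jordan quiver (one vertex, two loops) with
twists `M₁`, `M₂`: the tensor algebra of `M₁ ⊕ M₂` over `𝒪_X`. -/
def jordanAlgebra : Sheaf (Opens.grothendieckTopology X.carrier) RingCat.{u} :=
  tensorAlgebra (M₁ ⊞ M₂)

/-- The morphism `𝒪_X ⟶ T_{𝒪_X}(M₁ ⊕ M₂)`. -/
def jordanUnit : structureSheaf X ⟶ jordanAlgebra M₁ M₂ :=
  tensorAlgebraUnit (M₁ ⊞ M₂)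

/-- A section of `M₁` as a section of the twisted quiver algebra. -/
def loop₁ (U : Opens X.carrier) (m : M₁.val.obj (op U)) : (jordanAlgebra M₁ M₂).obj.obj (op U) :=
  tensorAlgebraι (M₁ ⊞ M₂) U ((biprod.inl : M₁ ⟶ M₁ ⊞ M₂).val.app (op U) m)

/-- A section of `M₂` as a section of the twisted quiver algebra. -/
def loop₂ (U : Opens X.carrier) (m : M₂.val.obj (op U)) : (jordanAlgebra M₁ M₂).obj.obj (op U) :=
  tensorAlgebraι (M₁ ⊞ M₂) U ((biprod.inr : M₂ ⟶ M₁ ⊞ M₂).val.app (op U) m)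

/-- The sheaf of two-sided ideals of the twisted quiver algebra generated by the commutators
`[m₁, m₂]` of local sections `m₁` of `M₁` and `m₂` of `M₂`. -/
def commutatorIdeal : IdealSheaf (jordanAlgebra M₁ M₂) :=
  IdealSheaf.generate fun U =>
    {s | ∃ (m₁ : M₁.val.obj (op U)) (m₂ : M₂.val.obj (op U)),
      s = loop₁ M₁ M₂ U m₁ * loop₂ M₁ M₂ U m₂ - loop₂ M₁ M₂ U m₂ * loop₁ M₁ M₂ U m₁}

end Jordan

end TwistedQuiver

end

/-! The question is local, so `M₁` and `M₂` may be taken free, with bases `x_i` and `y_j`; the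
tensor algebra is then the free algebra on these letters. The rule `x_i y_j = y_j x_i + [x_i, y_j]`,
with the commutator treated as a new letter, turns every element into a combination of normal words,
in which no `x` is immediately followed by a `y`. These are also linearly independent: the rewriting
defines an action of the tensor algebra on formal combinations of normal words, and the value of a
normal word sends the empty word to that normal word (`normalAction_eval`). This gives
`normalBasis`.

Rewriting never loses a commutator, and left multiplication by a commutator adds one. Hence the
`p`-th power of the commutator ideal is spanned by the normal words with at least `p` commutators,
and those with exactly `p` form a basis of the graded piece; this is (K1). A normal word with a
commutator factors uniquely as a block (a sorted word times a commutator) and a normal word, so the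
ideal is free as a right module on the blocks (`blockSum_injective`, `exists_blockSum_eq`).
Tensoring with it is locally a direct sum of copies of the left module, which preserves injections;
this is (K2).

What remains is the passage to sheaves. The algebra holds over every small open set, compatibly with
restriction (`Frame`, `GradedFrame`), and is carried to the associated sheaf of rings along a map
`q` that is locally injective and locally surjective. The transfer rests on
`mem_pow_generatedIdeal`, `isFlatRight_of_frames` and `isLocallyFree_graded_of_frames`. -/

noncomputable section

namespace TwistedQuiver

/-! ### The filtration by powers of a commutator ideal -/

section Filtration

variable {A B : Type u} [Ring A] [Ring B]

/-- The `p`-th power of the two-sided ideal generated by a set `C`, with the whole ring for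
`p = 0`. -/
def idealPower (C : Set A) : ℕ → AddSubgroup A
  | 0 => ⊤
  | p + 1 => AddSubgroup.closure {z | ∃ a, ∃ c ∈ C, ∃ d ∈ idealPower C p, z = a * c * d}

lemma mul_mul_mem_idealPower {C : Set A} {p : ℕ} (a : A) {c d : A} (hc : c ∈ C)
    (hd : d ∈ idealPower C p) : a * c * d ∈ idealPower C (p + 1) :=
  AddSubgroup.subset_closure ⟨a, c, hc, d, hd, rfl⟩

/-- All left multiples of `t` enter the hypothesis because at `p = 0` the factor `s` is arbitrary.
-/
lemma mul_mem_idealPower_add {C : Set A} {p q : ℕ} {s t : A} (hs : s ∈ idealPower C p)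
    (h : ∀ a, a * t ∈ idealPower C q) :
    s * t ∈ idealPower C (p + q) := by
  induction p generalizing s with
  | zero => simpa using h s
  | succ p ih =>
    rw [Nat.succ_add]
    induction hs using AddSubgroup.closure_induction with
    | mem x hx =>
      obtain ⟨a, c, hc, d, hd, rfl⟩ := hx
      rw [mul_assoc]
      exact mul_mul_mem_idealPower a hc (ih hd)
    | zero => simp
    | add x y _ _ hx hy => rw [add_mul]; exact add_mem hx hy
    | neg x _ hx => rw [neg_mul]; exact neg_mem hx

lemma mul_mem_idealPower_left {C : Set A} {p : ℕ} (a : A) {t : A} (ht : t ∈ idealPower C p) :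
    a * t ∈ idealPower C p := by
  cases p with
  | zero => trivial
  | succ p =>
    induction ht using AddSubgroup.closure_induction with
    | mem x hx =>
      obtain ⟨b, c, hc, d, hd, rfl⟩ := hx
      rw [← mul_assoc, ← mul_assoc]
      exact mul_mul_mem_idealPower (a * b) hc hd
    | zero => simp
    | add x y _ _ hx hy => rw [mul_add]; exact add_mem hx hy
    | neg x _ hx => rw [mul_neg]; exact neg_mem hx

lemma mul_mem_idealPower {C : Set A} {p q : ℕ} {s t : A} (hs : s ∈ idealPower C p)
    (ht : t ∈ idealPower C q) : s * t ∈ idealPower C (p + q) :=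
  mul_mem_idealPower_add hs fun a => mul_mem_idealPower_left a ht

lemma mul_mem_idealPower_right {C : Set A} {p : ℕ} {s : A} (hs : s ∈ idealPower C p) (a : A) :
    s * a ∈ idealPower C p :=
  mul_mem_idealPower (q := 0) hs (AddSubgroup.mem_top a)

lemma subset_idealPower_one {C : Set A} {c : A} (hc : c ∈ C) : c ∈ idealPower C 1 := by
  simpa using mul_mul_mem_idealPower (p := 0) 1 hc (AddSubgroup.mem_top (1 : A))

lemma map_mem_idealPower {C : Set A} {D : Set B} (f : A →+* B) (hf : ∀ c ∈ C, f c ∈ D) {p : ℕ}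
    {s : A} (hs : s ∈ idealPower C p) : f s ∈ idealPower D p := by
  induction p generalizing s with
  | zero => trivial
  | succ p ih =>
    induction hs using AddSubgroup.closure_induction with
    | mem x hx =>
      obtain ⟨a, c, hc, d, hd, rfl⟩ := hx
      rw [map_mul, map_mul]
      exact mul_mul_mem_idealPower _ (hf c hc) (ih hd)
    | zero => simp
    | add x y _ _ hx hy => rw [map_add]; exact add_mem hx hy
    | neg x _ hx => rw [map_neg]; exact neg_mem hx

end Filtration

/-! ### Normal words in a free algebra on two families of letters -/

section NormalWords

/-- Words of the form `y ⋯ y x ⋯ x`. -/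
abbrev SortedWord (ι₁ ι₂ : Type u) : Type u := List ι₂ × List ι₁

/-- Sorted words followed by a commutator `[x_i, y_j]`. -/
abbrev Block (ι₁ ι₂ : Type u) : Type u := SortedWord ι₁ ι₂ × ι₁ × ι₂

/-- Words in the letters `x`, `y` and the commutators `[x, y]` in which no `x` is followed
by a `y`. -/
abbrev NormalWord (ι₁ ι₂ : Type u) : Type u := List (Block ι₁ ι₂) × SortedWord ι₁ ι₂

variable {ι₁ ι₂ A B : Type u} [Ring A] [Ring B] (x : ι₁ → A) (y : ι₂ → A)

/-- The value of a sorted word. -/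
def SortedWord.eval (w : SortedWord ι₁ ι₂) : A := (w.1.map y).prod * (w.2.map x).prod

/-- The commutator `[x_i, y_j]`. -/
def comm (c : ι₁ × ι₂) : A := x c.1 * y c.2 - y c.2 * x c.1

/-- The value of a block. -/
def Block.eval (b : Block ι₁ ι₂) : A := SortedWord.eval x y b.1 * comm x y b.2

/-- The value of a normal word. -/
def NormalWord.eval (w : NormalWord ι₁ ι₂) : A :=
  (w.1.map (Block.eval x y)).prod * SortedWord.eval x y w.2

lemma NormalWord.eval_cons (b : Block ι₁ ι₂) (l : List (Block ι₁ ι₂)) (n : SortedWord ι₁ ι₂) :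
    NormalWord.eval x y (b :: l, n) = Block.eval x y b * NormalWord.eval x y (l, n) := by
  simp [NormalWord.eval, mul_assoc]

lemma SortedWord.map_eval (f : A →+* B) (w : SortedWord ι₁ ι₂) :
    f (SortedWord.eval x y w) = SortedWord.eval (f ∘ x) (f ∘ y) w := by
  simp [SortedWord.eval, map_list_prod, List.map_map]

lemma Block.map_eval (f : A →+* B) (b : Block ι₁ ι₂) :
    f (Block.eval x y b) = Block.eval (f ∘ x) (f ∘ y) b := by
  simp [Block.eval, SortedWord.map_eval, comm]

lemma NormalWord.map_eval (f : A →+* B) (w : NormalWord ι₁ ι₂) :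
    f (NormalWord.eval x y w) = NormalWord.eval (f ∘ x) (f ∘ y) w := by
  simp only [NormalWord.eval, map_mul, SortedWord.map_eval, map_list_prod, List.map_map]
  congr 3
  exact funext fun b => Block.map_eval x y f b

lemma NormalWord.eval_mem_idealPower {C : Set A} (hC : ∀ c, comm x y c ∈ C)
    (w : NormalWord ι₁ ι₂) : NormalWord.eval x y w ∈ idealPower C w.1.length := by
  obtain ⟨l, n⟩ := w
  induction l with
  | nil => trivial
  | cons b l ih =>
    rw [NormalWord.eval_cons, Block.eval]
    exact mul_mul_mem_idealPower _ (hC _) ih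

/-- Prepend the letter `y_j` to a normal word. -/
def NormalWord.consY (j : ι₂) : NormalWord ι₁ ι₂ → NormalWord ι₁ ι₂
  | ([], (v, u)) => ([], (j :: v, u))
  | (((v, u), c) :: l, n) => (((j :: v, u), c) :: l, n)

lemma NormalWord.eval_consY (j : ι₂) (w : NormalWord ι₁ ι₂) :
    NormalWord.eval x y (NormalWord.consY j w) = y j * NormalWord.eval x y w := by
  obtain ⟨_ | ⟨⟨⟨v, u⟩, c⟩, l⟩, n⟩ := w <;>
  simp [NormalWord.consY, NormalWord.eval, SortedWord.eval, Block.eval, mul_assoc]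

lemma NormalWord.length_consY (j : ι₂) (w : NormalWord ι₁ ι₂) :
    (NormalWord.consY j w).1.length = w.1.length := by
  obtain ⟨_ | ⟨⟨⟨v, u⟩, c⟩, l⟩, n⟩ := w <;> rfl

variable (R : Type u) [CommRing R]

/-- The normal form of `x_i w`, where the normal word `w = k v u` begins with the sorted word
`(v, u)`. -/
def NormalWord.mulXAux (i : ι₁) : List ι₂ → List ι₁ → (List ι₂ → List ι₁ → NormalWord ι₁ ι₂) →
    (NormalWord ι₁ ι₂ →₀ R)
  | [], u, k => Finsupp.single (k [] (i :: u)) 1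
  -- This is `x_i y_j w = [x_i, y_j] w + y_j (x_i w)`; the recursion moves `x_i` past the leading
  -- `y`s, one at a time.
  | j :: v, u, k => Finsupp.single ((([], []), i, j) :: (k v u).1, (k v u).2) 1 +
      Finsupp.lmapDomain R R (NormalWord.consY j) (NormalWord.mulXAux i v u k)

/-- The normal form of `x_i w`. -/
def NormalWord.mulX (i : ι₁) : NormalWord ι₁ ι₂ → (NormalWord ι₁ ι₂ →₀ R)
  | ([], (v, u)) => NormalWord.mulXAux R i v u fun v u => ([], (v, u))
  | (((v, u), c) :: l, n) => NormalWord.mulXAux R i v u fun v u => (((v, u), c) :: l, n)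

lemma NormalWord.mulX_consY (i : ι₁) (j : ι₂) (w : NormalWord ι₁ ι₂) :
    NormalWord.mulX R i (NormalWord.consY j w) =
      Finsupp.single ((([], []), i, j) :: w.1, w.2) 1 +
        Finsupp.lmapDomain R R (NormalWord.consY j) (NormalWord.mulX R i w) := by
  obtain ⟨_ | ⟨⟨⟨v, u⟩, c⟩, l⟩, n⟩ := w <;> rfl

variable [Algebra R A]

/-- Linear combinations of values of normal words. -/
def NormalWord.evalLinear : (NormalWord ι₁ ι₂ →₀ R) →ₗ[R] A :=
  Finsupp.linearCombination R (NormalWord.eval x y)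

lemma NormalWord.evalLinear_single (w : NormalWord ι₁ ι₂) :
    NormalWord.evalLinear x y R (Finsupp.single w 1) = NormalWord.eval x y w := by
  simp [NormalWord.evalLinear]

lemma NormalWord.evalLinear_consY (j : ι₂) (p : NormalWord ι₁ ι₂ →₀ R) :
    NormalWord.evalLinear x y R (Finsupp.lmapDomain R R (NormalWord.consY j) p) =
      y j * NormalWord.evalLinear x y R p := by
  suffices h : NormalWord.evalLinear x y R ∘ₗ Finsupp.lmapDomain R R (NormalWord.consY j) =
      LinearMap.mulLeft R (y j) ∘ₗ NormalWord.evalLinear x y R from LinearMap.congr_fun h p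
  ext w
  simp [NormalWord.evalLinear, NormalWord.eval_consY]

/-- The rewriting rule is an identity in every algebra. The hypothesis `hk` says that `k` appends a
fixed tail of value `z` to the leading sorted word. -/
lemma NormalWord.evalLinear_mulXAux (i : ι₁) (z : A) (v : List ι₂) (u : List ι₁)
    (k : List ι₂ → List ι₁ → NormalWord ι₁ ι₂)
    (hk : ∀ v u, NormalWord.eval x y (k v u) = SortedWord.eval x y (v, u) * z) :
    NormalWord.evalLinear x y R (NormalWord.mulXAux R i v u k) =
      x i * NormalWord.eval x y (k v u) := by
  induction v with
  | nil =>
    rw [NormalWord.mulXAux, NormalWord.evalLinear_single, hk, hk]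
    simp [SortedWord.eval, mul_assoc]
  | cons j v ih =>
    rw [NormalWord.mulXAux, map_add, NormalWord.evalLinear_single, NormalWord.evalLinear_consY, ih,
      NormalWord.eval_cons, hk, hk]
    simp only [Block.eval, SortedWord.eval, comm, List.map_nil, List.prod_nil, mul_one, one_mul,
      List.map_cons, List.prod_cons]
    noncomm_ring

lemma NormalWord.evalLinear_mulX (i : ι₁) (w : NormalWord ι₁ ι₂) :
    NormalWord.evalLinear x y R (NormalWord.mulX R i w) = x i * NormalWord.eval x y w := by
  obtain ⟨_ | ⟨⟨⟨v, u⟩, c⟩, l⟩, n⟩ := w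
  · exact NormalWord.evalLinear_mulXAux x y R i 1 _ _ _ fun v u => by simp [NormalWord.eval]
  · exact NormalWord.evalLinear_mulXAux x y R i
      (comm x y c * NormalWord.eval x y (l, n)) _ _ _ fun v u => by
        simp [NormalWord.eval, Block.eval, mul_assoc]

lemma NormalWord.lmapDomain_consY_mem_supported {p : ℕ} (j : ι₂) {f : NormalWord ι₁ ι₂ →₀ R}
    (hf : f ∈ Finsupp.supported R R {w : NormalWord ι₁ ι₂ | p ≤ w.1.length}) :
    Finsupp.lmapDomain R R (NormalWord.consY j) f ∈
      Finsupp.supported R R {w : NormalWord ι₁ ι₂ | p ≤ w.1.length} := by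
  classical
  intro w hw
  obtain ⟨w', hw', rfl⟩ := Finset.mem_image.1 (Finsupp.mapDomain_support hw)
  exact (hf hw').trans (NormalWord.length_consY j w').ge

lemma NormalWord.mulXAux_mem_supported {p : ℕ} (i : ι₁) (v : List ι₂) (u : List ι₁)
    (k : List ι₂ → List ι₁ → NormalWord ι₁ ι₂) (hk : ∀ v u, p ≤ (k v u).1.length) :
    NormalWord.mulXAux R i v u k ∈
      Finsupp.supported R R {w : NormalWord ι₁ ι₂ | p ≤ w.1.length} := by
  induction v with
  | nil => exact Finsupp.single_mem_supported R _ (hk _ _)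
  | cons j v ih =>
    refine add_mem (Finsupp.single_mem_supported R _ ?_)
      (NormalWord.lmapDomain_consY_mem_supported R j ih)
    exact (hk v u).trans (Nat.le_succ _)

/-- Each rewriting step either keeps the commutators present or creates one more. -/
lemma NormalWord.mulX_mem_supported (i : ι₁) (w : NormalWord ι₁ ι₂) :
    NormalWord.mulX R i w ∈
      Finsupp.supported R R {w' : NormalWord ι₁ ι₂ | w.1.length ≤ w'.1.length} := by
  obtain ⟨_ | ⟨⟨⟨v, u⟩, c⟩, l⟩, n⟩ := w <;>
  exact NormalWord.mulXAux_mem_supported R i _ _ _ fun v u => le_rfl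

end NormalWords

/-! ### The normal form in the tensor algebra of a free module -/

section NormalForm

variable {R M ι₁ ι₂ : Type u} [CommRing R] [AddCommGroup M] [Module R M]
  (b : Module.Basis (ι₁ ⊕ ι₂) R M)

/-- The letters `x_i`. -/
def letterX (i : ι₁) : TensorAlgebra R M := TensorAlgebra.ι R (b (Sum.inl i))

/-- The letters `y_j`. -/
def letterY (j : ι₂) : TensorAlgebra R M := TensorAlgebra.ι R (b (Sum.inr j))

/-- The left action of the tensor algebra on combinations of normal words. -/
def normalAction : TensorAlgebra R M →ₐ[R] Module.End R (NormalWord ι₁ ι₂ →₀ R) :=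
  TensorAlgebra.lift R (b.constr R (Sum.elim
    (fun i => Finsupp.linearCombination R (NormalWord.mulX R i))
    (fun j => Finsupp.lmapDomain R R (NormalWord.consY j))))

lemma normalAction_letterX (i : ι₁) : normalAction b (letterX b i) =
    Finsupp.linearCombination R (NormalWord.mulX R i) := by
  simp [normalAction, letterX]

lemma normalAction_letterY (j : ι₂) : normalAction b (letterY b j) =
    Finsupp.lmapDomain R R (NormalWord.consY j) := by
  simp [normalAction, letterY]

lemma tensorAlgebra_basis_induction {p : TensorAlgebra R M → Prop}
    (hr : ∀ r, p (algebraMap R _ r)) (hx : ∀ i, p (letterX b i)) (hy : ∀ j, p (letterY b j))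
    (hmul : ∀ s t, p s → p t → p (s * t)) (hadd : ∀ s t, p s → p t → p (s + t))
    (s : TensorAlgebra R M) : p s := by
  induction s using TensorAlgebra.induction with
  | algebraMap r => exact hr r
  | mul s t hs ht => exact hmul s t hs ht
  | add s t hs ht => exact hadd s t hs ht
  | ι m =>
    induction b.mem_span m using Submodule.span_induction with
    | zero => simpa using hr 0
    | add s t _ _ hs ht => rw [map_add]; exact hadd _ _ hs ht
    | smul r m _ hm =>
      rw [map_smul, Algebra.smul_def]
      exact hmul _ _ (hr r) hm
    | mem m hm =>
      obtain ⟨i | j, rfl⟩ := hm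
      exacts [hx i, hy j]

/-- Evaluation intertwines the action with left multiplication: both sides are multiplicative in
`a`, and on letters this is the rewriting identity. Applied to the empty word, it shows that normal
words span. -/
lemma evalLinear_normalAction (a : TensorAlgebra R M) (p : NormalWord ι₁ ι₂ →₀ R) :
    NormalWord.evalLinear (letterX b) (letterY b) R (normalAction b a p) =
      a * NormalWord.evalLinear (letterX b) (letterY b) R p := by
  induction a using tensorAlgebra_basis_induction b generalizing p with
  | hr r => simp [Algebra.smul_def, Module.algebraMap_end_apply]
  | hx i =>
    rw [normalAction_letterX]
    induction p using Finsupp.induction_linear with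
    | zero => simp
    | add p q hp hq => simp [hp, hq, mul_add]
    | single w r =>
      simp [NormalWord.evalLinear]
      rw [← NormalWord.evalLinear, NormalWord.evalLinear_mulX]
  | hy j => rw [normalAction_letterY, NormalWord.evalLinear_consY]
  | hmul s t hs ht => rw [map_mul, Module.End.mul_apply, hs, ht, mul_assoc]
  | hadd s t hs ht => rw [map_add, LinearMap.add_apply, map_add, hs, ht, add_mul]

/-- By `mulX_consY`, `x_i (y_j w)` is the word `[x_i, y_j] w` plus `y_j (x_i w)`, and the second
term cancels against `y_j (x_i w)`. -/
lemma normalAction_comm (c : ι₁ × ι₂) (w : NormalWord ι₁ ι₂) :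
    normalAction b (comm (letterX b) (letterY b) c) (Finsupp.single w 1) =
      Finsupp.single ((([], []), c) :: w.1, w.2) 1 := by
  simp only [comm, map_sub, map_mul, LinearMap.sub_apply, Module.End.mul_apply,
    normalAction_letterX, normalAction_letterY, Finsupp.lmapDomain_apply, Finsupp.mapDomain_single,
    Finsupp.linearCombination_single, one_smul, NormalWord.mulX_consY]
  simp

/-- After the commutator is prepended the word has an empty leading sorted word, so the letters `x`,
and after them the letters `y`, are put in front with no rewriting at all. -/
lemma normalAction_block (β : Block ι₁ ι₂) (w : NormalWord ι₁ ι₂) :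
    normalAction b (Block.eval (letterX b) (letterY b) β) (Finsupp.single w 1) =
      Finsupp.single (β :: w.1, w.2) 1 := by
  obtain ⟨⟨v, u⟩, c⟩ := β
  rw [Block.eval, map_mul, Module.End.mul_apply, normalAction_comm, SortedWord.eval, map_mul,
    Module.End.mul_apply]
  have hu : normalAction b (u.map (letterX b)).prod
      (Finsupp.single ((([], []), c) :: w.1, w.2) 1) =
      Finsupp.single ((([], u), c) :: w.1, w.2) 1 := by
    induction u with
    | nil => simp
    | cons i u ih =>
      rw [List.map_cons, List.prod_cons, map_mul, Module.End.mul_apply, ih, normalAction_letterX]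
      simp [NormalWord.mulX, NormalWord.mulXAux]
  rw [hu]
  induction v with
  | nil => simp
  | cons j v ih =>
    rw [List.map_cons, List.prod_cons, map_mul, Module.End.mul_apply, ih, normalAction_letterY]
    simp [NormalWord.consY]

lemma normalAction_sortedWord (n : SortedWord ι₁ ι₂) :
    normalAction b (SortedWord.eval (letterX b) (letterY b) n) (Finsupp.single ([], [], []) 1) =
      Finsupp.single ([], n) 1 := by
  obtain ⟨v, u⟩ := n
  rw [SortedWord.eval, map_mul, Module.End.mul_apply]
  have hu : normalAction b (u.map (letterX b)).prod (Finsupp.single ([], [], []) 1) =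
      Finsupp.single ([], [], u) 1 := by
    induction u with
    | nil => simp
    | cons i u ih =>
      rw [List.map_cons, List.prod_cons, map_mul, Module.End.mul_apply, ih, normalAction_letterX]
      simp [NormalWord.mulX, NormalWord.mulXAux]
  rw [hu]
  induction v with
  | nil => simp
  | cons j v ih =>
    rw [List.map_cons, List.prod_cons, map_mul, Module.End.mul_apply, ih, normalAction_letterY]
    simp [NormalWord.consY]

/-- The source of linear independence: a normal word is recovered from its value by letting the
value act on the empty word. -/
lemma normalAction_eval (w : NormalWord ι₁ ι₂) :
    normalAction b (NormalWord.eval (letterX b) (letterY b) w) (Finsupp.single ([], [], []) 1) =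
      Finsupp.single w 1 := by
  obtain ⟨l, n⟩ := w
  induction l with
  | nil => simpa [NormalWord.eval] using normalAction_sortedWord b n
  | cons β l ih =>
    rw [NormalWord.eval_cons, map_mul, Module.End.mul_apply, ih, normalAction_block]

/-- The basis of the tensor algebra that consists of the values of the normal words. -/
def normalBasis : Module.Basis (NormalWord ι₁ ι₂) R (TensorAlgebra R M) where
  repr := LinearEquiv.ofLinearMap
    (LinearMap.applyₗ (Finsupp.single ([], [], []) 1) ∘ₗ (normalAction b).toLinearMap)
    (NormalWord.evalLinear (letterX b) (letterY b) R)
    (by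
      ext w : 2
      simp [NormalWord.evalLinear, normalAction_eval])
    (by
      ext a
      -- The empty word has value `1`, so letting `a` act on it and evaluating returns `a * 1`.
      simp [evalLinear_normalAction, NormalWord.evalLinear_single, NormalWord.eval,
        SortedWord.eval])

lemma normalBasis_apply (w : NormalWord ι₁ ι₂) :
    normalBasis b w = NormalWord.eval (letterX b) (letterY b) w :=
  NormalWord.evalLinear_single _ _ R w

end NormalForm

/-! ### Sums of right multiples of blocks -/

section BlockSum

variable {ι₁ ι₂ A B : Type u} [Ring A] [Ring B] (x : ι₁ → A) (y : ι₂ → A)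

/-- The sum `∑ β * f β` over blocks `β`. -/
def blockSum : (Block ι₁ ι₂ →₀ A) →+ A :=
  Finsupp.liftAddHom fun β => AddMonoidHom.mulLeft (Block.eval x y β)

lemma blockSum_single (β : Block ι₁ ι₂) (a : A) :
    blockSum x y (Finsupp.single β a) = Block.eval x y β * a := by
  simp [blockSum]

lemma map_blockSum (g : A →+* B) (f : Block ι₁ ι₂ →₀ A) :
    g (blockSum x y f) = blockSum (g ∘ x) (g ∘ y) (f.mapRange g (map_zero g)) := by
  induction f using Finsupp.induction_linear with
  | zero => simp
  | add f₁ f₂ h₁ h₂ => rw [map_add, map_add, h₁, h₂, Finsupp.mapRange_add (map_add g), map_add]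
  | single β a =>
    rw [Finsupp.mapRange_single, blockSum_single, blockSum_single, map_mul, Block.map_eval]

lemma blockSum_mul (f : Block ι₁ ι₂ →₀ A) (a : A) :
    blockSum x y f * a = blockSum x y (f.mapRange (· * a) (zero_mul a)) := by
  induction f using Finsupp.induction_linear with
  | zero => simp
  | add f₁ f₂ h₁ h₂ =>
    rw [map_add, add_mul, h₁, h₂, Finsupp.mapRange_add fun s t => add_mul s t a, map_add]
  | single β b =>
    rw [Finsupp.mapRange_single, blockSum_single, blockSum_single, mul_assoc]

lemma blockSum_mem_idealPower {C : Set A} (hC : ∀ c, comm x y c ∈ C) (f : Block ι₁ ι₂ →₀ A) :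
    blockSum x y f ∈ idealPower C 1 := by
  induction f using Finsupp.induction_linear with
  | zero => simp
  | add f₁ f₂ h₁ h₂ => rw [map_add]; exact add_mem h₁ h₂
  | single β b =>
    rw [blockSum_single]
    exact mul_mul_mem_idealPower (p := 0) _ (hC _) (AddSubgroup.mem_top b)

end BlockSum

/-! ### Powers of the commutator ideal in the basis of normal words -/

section NormalForm

variable {R M ι₁ ι₂ : Type u} [CommRing R] [AddCommGroup M] [Module R M]
  (b : Module.Basis (ι₁ ⊕ ι₂) R M) {C : Set (TensorAlgebra R M)}

lemma normalBasis_repr_apply (a : TensorAlgebra R M) :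
    (normalBasis b).repr a = normalAction b a (Finsupp.single ([], [], []) 1) := rfl

lemma normalBasis_repr_mul (a c : TensorAlgebra R M) :
    (normalBasis b).repr (a * c) = normalAction b a ((normalBasis b).repr c) := by
  rw [normalBasis_repr_apply, map_mul]; rfl

/-- Combinations of normal words with at least `p` commutators. -/
abbrev longWords (R ι₁ ι₂ : Type u) [CommRing R] (p : ℕ) :
    Submodule R (NormalWord ι₁ ι₂ →₀ R) :=
  Finsupp.supported R R {w : NormalWord ι₁ ι₂ | p ≤ w.1.length}

lemma map_mem_of_single_mem {S : Submodule R (NormalWord ι₁ ι₂ →₀ R)} {p : ℕ}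
    (φ : Module.End R (NormalWord ι₁ ι₂ →₀ R))
    (h : ∀ w : NormalWord ι₁ ι₂, p ≤ w.1.length → φ (Finsupp.single w 1) ∈ S)
    {f : NormalWord ι₁ ι₂ →₀ R} (hf : f ∈ longWords R ι₁ ι₂ p) : φ f ∈ S := by
  rw [longWords, Finsupp.supported_eq_span_single] at hf
  induction hf using Submodule.span_induction with
  | mem f hf =>
    obtain ⟨w, hw, rfl⟩ := hf
    exact h w hw
  | zero => simp
  | add f g _ _ hf hg => rw [map_add]; exact add_mem hf hg
  | smul r f _ hf => rw [map_smul]; exact S.smul_mem r hf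

/-- Scalars and the letters `y` keep the number of commutators and the letters `x` never lower it,
so these combinations are stable under the whole algebra. -/
lemma normalAction_mem_longWords {p : ℕ} (a : TensorAlgebra R M) {f : NormalWord ι₁ ι₂ →₀ R}
    (hf : f ∈ longWords R ι₁ ι₂ p) : normalAction b a f ∈ longWords R ι₁ ι₂ p := by
  induction a using tensorAlgebra_basis_induction b generalizing f with
  | hr r =>
    rw [AlgHom.commutes, Module.algebraMap_end_apply]
    exact Submodule.smul_mem _ r hf
  | hx i =>
    refine map_mem_of_single_mem _ (fun w hw => ?_) hf
    rw [normalAction_letterX, Finsupp.linearCombination_single, one_smul]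
    exact Finsupp.supported_mono (fun w' hw' => hw.trans hw') (NormalWord.mulX_mem_supported R i w)
  | hy j =>
    rw [normalAction_letterY]
    exact NormalWord.lmapDomain_consY_mem_supported R j hf
  | hmul s t hs ht => rw [map_mul]; exact hs (ht hf)
  | hadd s t hs ht => rw [map_add]; exact add_mem (hs hf) (ht hf)

lemma normalAction_mem_longWords_succ {p : ℕ} {c : TensorAlgebra R M}
    (hc : c ∈ Submodule.span R (Set.range (comm (letterX b) (letterY b))))
    {f : NormalWord ι₁ ι₂ →₀ R} (hf : f ∈ longWords R ι₁ ι₂ p) :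
    normalAction b c f ∈ longWords R ι₁ ι₂ (p + 1) := by
  induction hc using Submodule.span_induction with
  | mem c hc =>
    obtain ⟨c, rfl⟩ := hc
    refine map_mem_of_single_mem _ (fun w hw => ?_) hf
    rw [normalAction_comm]
    exact Finsupp.single_mem_supported R _ (Nat.succ_le_succ hw)
  | zero => simp
  | add c d _ _ hc hd => rw [map_add]; exact add_mem hc hd
  | smul r c _ hc => rw [map_smul]; exact Submodule.smul_mem _ r hc

lemma idealPower_antitone {A : Type u} [Ring A] (C : Set A) : Antitone (idealPower C) := by
  refine antitone_nat_of_succ_le fun p => ?_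
  rw [idealPower, AddSubgroup.closure_le]
  rintro _ ⟨a, c, -, d, hd, rfl⟩
  exact mul_mem_idealPower_left _ hd

/-- A generator `a * c * d` has one commutator `c` more than `d`, and acting with `a` loses none.
The set `C` only has to lie in the span of the commutators of letters, so all commutators of
sections are allowed. -/
lemma normalBasis_repr_mem_longWords
    (hC : C ⊆ Submodule.span R (Set.range (comm (letterX b) (letterY b)))) {p : ℕ}
    {a : TensorAlgebra R M} (ha : a ∈ idealPower C p) :
    (normalBasis b).repr a ∈ longWords R ι₁ ι₂ p := by
  induction p generalizing a with
  | zero => exact fun w _ => Nat.zero_le _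
  | succ p ih =>
    induction ha using AddSubgroup.closure_induction with
    | mem x hx =>
      obtain ⟨a, c, hc, d, hd, rfl⟩ := hx
      rw [mul_assoc, normalBasis_repr_mul, normalBasis_repr_mul]
      exact normalAction_mem_longWords b a (normalAction_mem_longWords_succ b (hC hc) (ih hd))
    | zero => simp
    | add x y _ _ hx hy => rw [map_add]; exact add_mem hx hy
    | neg x _ hx => rw [map_neg]; exact neg_mem hx

/-- A combination of long normal words, minus those with exactly `p` commutators, lies in the next
power of the ideal. -/
lemma sub_sum_mem_idealPower_succ (hC₁ : ∀ c, comm (letterX b) (letterY b) c ∈ C)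
    (hC₂ : C ⊆ Submodule.span R (Set.range (comm (letterX b) (letterY b)))) {p : ℕ}
    {a : TensorAlgebra R M} (ha : a ∈ idealPower C p) :
    ∃ f : {w : NormalWord ι₁ ι₂ // w.1.length = p} →₀ R,
      a - f.sum (fun w r => r • NormalWord.eval (letterX b) (letterY b) w.1) ∈
        idealPower C (p + 1) := by
  have ha' := normalBasis_repr_mem_longWords b hC₂ ha
  rw [← (normalBasis b).linearCombination_repr a]
  generalize (normalBasis b).repr a = g at ha' ⊢
  rw [longWords, Finsupp.supported_eq_span_single] at ha'
  induction ha' using Submodule.span_induction with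
  | mem g hg =>
    obtain ⟨w, hw, rfl⟩ := hg
    -- A word with exactly `p` commutators goes into `f`; a longer one already lies in the next
    -- power.
    rcases (show p ≤ w.1.length from hw).eq_or_lt with h | h
    · refine ⟨Finsupp.single ⟨w, h.symm⟩ 1, ?_⟩
      simp [normalBasis_apply]
    · refine ⟨0, ?_⟩
      simpa [normalBasis_apply] using idealPower_antitone C (Nat.succ_le_iff.2 h)
        (NormalWord.eval_mem_idealPower _ _ hC₁ w)
  | zero => exact ⟨0, by simp⟩
  | add g h _ _ hg hh =>
    obtain ⟨f₁, h₁⟩ := hg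
    obtain ⟨f₂, h₂⟩ := hh
    refine ⟨f₁ + f₂, ?_⟩
    rw [Finsupp.sum_add_index' (by simp) (by simp [add_smul]), map_add, add_sub_add_comm]
    exact add_mem h₁ h₂
  | smul r g _ hg =>
    obtain ⟨f, h⟩ := hg
    refine ⟨r • f, ?_⟩
    rw [Finsupp.sum_smul_index (by simp), map_smul]
    simp only [mul_smul, ← Finsupp.smul_sum, ← smul_sub, Algebra.smul_def r (_ - _)]
    exact mul_mem_idealPower_left _ h

/-- The coordinates of the sum in `normalBasis` sit on words with exactly `p` commutators, while
membership in the next power puts them on words with at least `p + 1`. -/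
lemma eq_zero_of_sum_mem_idealPower_succ
    (hC : C ⊆ Submodule.span R (Set.range (comm (letterX b) (letterY b)))) {p : ℕ}
    {f : {w : NormalWord ι₁ ι₂ // w.1.length = p} →₀ R}
    (hf : f.sum (fun w r => r • NormalWord.eval (letterX b) (letterY b) w.1) ∈
        idealPower C (p + 1)) : f = 0 := by
  have h := normalBasis_repr_mem_longWords b hC hf
  have h' : f.sum (fun w r => r • NormalWord.eval (letterX b) (letterY b) w.1) =
      Finsupp.linearCombination R (normalBasis b) (f.mapDomain Subtype.val) := by
    rw [Finsupp.linearCombination_mapDomain, Finsupp.linearCombination_apply]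
    simp [normalBasis_apply]
  rw [h', Module.Basis.repr_linearCombination] at h
  ext w
  rw [Finsupp.zero_apply, ← Finsupp.mapDomain_apply Subtype.val_injective f w]
  by_contra hw
  have := h (Finsupp.mem_support_iff.2 hw)
  have hw' := w.2
  simp only [Set.mem_ofPred_eq] at this
  omega

/-- Unique factorisation of a normal word into its first block and the rest: the linear map `G`
strips off the first block and is a left inverse. -/
lemma blockSum_injective : Function.Injective (blockSum (letterX b) (letterY b)) := by
  let E : (Block ι₁ ι₂ →₀ TensorAlgebra R M) →ₗ[R] TensorAlgebra R M :=
    Finsupp.lsum R fun β => LinearMap.mulLeft R (Block.eval (letterX b) (letterY b) β)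
  let G : TensorAlgebra R M →ₗ[R] (Block ι₁ ι₂ →₀ TensorAlgebra R M) :=
    (normalBasis b).constr R fun w => match w with
      | ([], _) => 0
      | (β :: l, n) => Finsupp.single β (NormalWord.eval (letterX b) (letterY b) (l, n))
  have h : G ∘ₗ E = LinearMap.id := by
    refine Finsupp.lhom_ext' fun β => (normalBasis b).ext fun w => ?_
    have : E (Finsupp.single β (normalBasis b w)) = normalBasis b (β :: w.1, w.2) := by
      simp [E, normalBasis_apply, NormalWord.eval_cons]
    simp only [LinearMap.comp_apply, Finsupp.lsingle_apply, this, LinearMap.id_apply]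
    exact ((normalBasis b).constr_basis R _ _).trans (by rw [normalBasis_apply])
  refine Function.LeftInverse.injective (g := G) fun f => ?_
  exact LinearMap.congr_fun h f

/-- An element of the ideal is a combination of words with at least one commutator, and each of
these begins with a block. -/
lemma exists_blockSum_eq
    (hC : C ⊆ Submodule.span R (Set.range (comm (letterX b) (letterY b))))
    {a : TensorAlgebra R M} (ha : a ∈ idealPower C 1) :
    ∃ f, blockSum (letterX b) (letterY b) f = a := by
  have ha' := normalBasis_repr_mem_longWords b hC ha
  rw [← (normalBasis b).linearCombination_repr a]
  generalize (normalBasis b).repr a = g at ha' ⊢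
  rw [longWords, Finsupp.supported_eq_span_single] at ha'
  induction ha' using Submodule.span_induction with
  | mem g hg =>
    obtain ⟨⟨l, n⟩, hw, rfl⟩ := hg
    cases l with
    | nil => simp at hw
    | cons β l =>
      exact ⟨Finsupp.single β (NormalWord.eval (letterX b) (letterY b) (l, n)), by
        simp [blockSum_single, normalBasis_apply, NormalWord.eval_cons]⟩
  | zero => exact ⟨0, by simp⟩
  | add g h _ _ hg hh =>
    obtain ⟨f₁, h₁⟩ := hg
    obtain ⟨f₂, h₂⟩ := hh
    exact ⟨f₁ + f₂, by simp [h₁, h₂]⟩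
  | smul r g _ hg =>
    obtain ⟨f, h⟩ := hg
    -- The coefficients stand to the right of the blocks, and the scalar `r` can be moved there
    -- because it is central.
    refine ⟨f.mapRange (· * algebraMap R _ r) (zero_mul _), ?_⟩
    rw [← blockSum_mul, h, map_smul, Algebra.smul_def, Algebra.commutes]

end NormalForm

/-! ### Local surjectivity and bases of sections on a site -/

section Site

variable {C : Type u} [SmallCategory C] {J : GrothendieckTopology C} {R : Sheaf J RingCat.{u}}

/-- The value over `U` of a global section. -/
def sectionAt {M : SheafOfModules.{u} R} (s : M.sections) (U : Cᵒᵖ) : M.val.obj U := s.val U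

lemma sectionAt_map {M : SheafOfModules.{u} R} (s : M.sections) {U V : Cᵒᵖ} (f : U ⟶ V) :
    M.val.restrictₛₗ f (sectionAt s U) = sectionAt s V :=
  s.property f

lemma isSheaf_of_locally_mem (M : SheafOfModules.{u} R) (N : M.val.Submodule)
    (hN : ∀ (U : C) (s : M.val.obj (op U)) (S : Sieve U), S ∈ J U →
      (∀ ⦃V : C⦄ (f : V ⟶ U), S f → M.val.restrictₛₗ f.op s ∈ N.obj (op V)) → s ∈ N.obj (op U)) :
    Presheaf.IsSheaf J N.toPresheafOfModules.presheaf := by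
  let G : Subfunctor (M.val.presheaf ⋙ forget AddCommGrpCat) :=
    { obj U := {s | (show M.val.obj U from s) ∈ N.obj U}
      map f _ hs := N.map f hs }
  rw [Presheaf.isSheaf_iff_isSheaf_forget _ _ (forget AddCommGrpCat), isSheaf_iff_isSheaf_of_type]
  have hM := (isSheaf_iff_isSheaf_of_type _ _).1
    ((Presheaf.isSheaf_iff_isSheaf_forget _ _ (forget AddCommGrpCat)).1 M.isSheaf)
  exact (G.isSheaf_iff hM).2 fun U s hs => hN U.unop s _ hs fun V f hf => hf

/-- Saturation of a submodule under gluing. -/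
def locallyMem (M : SheafOfModules.{u} R) (N : M.val.Submodule) : M.val.Submodule where
  obj U :=
    { carrier := {s | ∃ S ∈ J U.unop, ∀ ⦃V : C⦄ (f : V ⟶ U.unop), S f →
        M.val.restrictₛₗ f.op s ∈ N.obj (op V)}
      add_mem' := by
        rintro a b ⟨S, hS, ha⟩ ⟨T, hT, hb⟩
        refine ⟨S ⊓ T, J.intersection_covering hS hT, fun V f hf => ?_⟩
        rw [map_add]
        exact add_mem (ha f hf.1) (hb f hf.2)
      zero_mem' := ⟨⊤, J.top_mem _, fun V f _ => by rw [map_zero]; exact zero_mem _⟩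
      smul_mem' := by
        rintro r a ⟨S, hS, ha⟩
        refine ⟨S, hS, fun V f hf => ?_⟩
        rw [map_smulₛₗ]
        exact Submodule.smul_mem _ _ (ha f hf) }
  map {U V} f s := by
    rintro ⟨S, hS, hs⟩
    refine ⟨S.pullback f.unop, J.pullback_stable _ hS, fun W g hg => ?_⟩
    rw [← restrict_comp]
    exact hs _ hg

lemma isSheaf_locallyMem (M : SheafOfModules.{u} R) (N : M.val.Submodule) :
    Presheaf.IsSheaf J (locallyMem M N).toPresheafOfModules.presheaf :=
  isSheaf_of_locally_mem M _ fun U s S hS h => by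
    choose T hT hT' using h
    refine ⟨Sieve.bind S (fun V f hf => T f hf), J.bind_covering hS fun V f hf => hT f hf, ?_⟩
    rintro W _ ⟨V, g, f, hf, hg, rfl⟩
    have := hT' f hf g hg
    rwa [← restrict_comp] at this

/-- The saturation of a submodule as a sheaf of modules. -/
def saturation (M : SheafOfModules.{u} R) (N : M.val.Submodule) : SheafOfModules.{u} R where
  val := (locallyMem M N).toPresheafOfModules
  isSheaf := isSheaf_locallyMem M N

/-- The inclusion of the saturation. -/
def saturationι (M : SheafOfModules.{u} R) (N : M.val.Submodule) : saturation M N ⟶ M where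
  val := (locallyMem M N).ι

instance (M : SheafOfModules.{u} R) (N : M.val.Submodule) : Mono (saturationι M N) :=
  (SheafOfModules.forget R).mono_of_mono_map (inferInstanceAs (Mono (locallyMem M N).ι))

/-- The inclusion of the saturation becomes both mono and epi, hence an isomorphism, the category of
sheaves of modules being abelian. Every section of `M` is then locally in `N`. -/
lemma locally_mem_of_epi (M : SheafOfModules.{u} R) (N : M.val.Submodule)
    {A : SheafOfModules.{u} R} (f : A ⟶ saturation M N) [Epi (f ≫ saturationι M N)] (U : C)
    (s : M.val.obj (op U)) :
    ∃ S ∈ J U, ∀ ⦃V : C⦄ (f : V ⟶ U), S f → M.val.restrictₛₗ f.op s ∈ N.obj (op V) := by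
  have : Epi (saturationι M N) := epi_of_epi f _
  have : IsIso (saturationι M N) := isIso_of_mono_of_epi _
  have h : (saturationι M N).val.app (op U) ((inv (saturationι M N)).val.app (op U) s) = s := by
    change (inv (saturationι M N) ≫ saturationι M N).val.app (op U) s = s
    rw [IsIso.inv_hom_id]
    rfl
  rw [← h]
  exact ((inv (saturationι M N)).val.app (op U) s).2

/-- An epimorphism factors through the saturation of its presheaf image, so the previous lemma makes
it locally surjective. -/
lemma locally_mem_range_of_epi {A B : SheafOfModules.{u} R} (f : A ⟶ B) [Epi f] (U : C)
    (s : B.val.obj (op U)) :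
    ∃ S ∈ J U, ∀ ⦃V : C⦄ (g : V ⟶ U), S g →
      ∃ a : A.val.obj (op V), f.val.app (op V) a = B.val.restrictₛₗ g.op s := by
  let N : B.val.Submodule :=
    { obj U := LinearMap.range (f.val.app U).hom
      map := by
        rintro U V g _ ⟨a, rfl⟩
        exact ⟨A.val.restrictₛₗ g a, PresheafOfModules.naturality_apply f.val g a⟩ }
  let g : A ⟶ saturation B N := ⟨PresheafOfModules.homMk
    { app U := AddCommGrpCat.ofHom
        ((f.val.app U).hom.codRestrict ((locallyMem B N).obj U) fun a =>
          ⟨⊤, J.top_mem _, fun V g _ => ⟨A.val.restrictₛₗ g.op a,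
            PresheafOfModules.naturality_apply f.val g.op a⟩⟩).toAddMonoidHom
      naturality U V i := by
        ext a
        exact Subtype.ext (PresheafOfModules.naturality_apply f.val i a) }
    fun U r a => Subtype.ext ((f.val.app U).hom.map_smul r a)⟩
  have hg : g ≫ saturationι B N = f := rfl
  have : Epi (g ≫ saturationι B N) := by rw [hg]; infer_instance
  exact locally_mem_of_epi B N g U s

/-- Sections of a free sheaf of modules are locally linear combinations of the generators. -/
lemma free_locally_span {I : Type u} (U : C)
    (s : (SheafOfModules.free (R := R) I).val.obj (op U)) :
    ∃ S ∈ J U, ∀ ⦃V : C⦄ (g : V ⟶ U), S g →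
      (SheafOfModules.free (R := R) I).val.restrictₛₗ g.op s ∈ Submodule.span (R.obj.obj (op V))
        (Set.range fun i => sectionAt (SheafOfModules.freeSection (R := R) i) (op V)) := by
  let M := SheafOfModules.free (R := R) I
  let N : M.val.Submodule :=
    { obj U := Submodule.span (R.obj.obj U)
        (Set.range fun i => sectionAt (SheafOfModules.freeSection (R := R) i) U)
      map {U V} f := by
        rw [Submodule.span_le]
        rintro _ ⟨i, rfl⟩
        refine Submodule.subset_span ⟨i, ?_⟩
        exact (sectionAt_map _ f).symm }
  let σ (i : I) : (saturation M N).sections :=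
    ⟨fun U => ⟨sectionAt (SheafOfModules.freeSection (R := R) i) U, ⊤, J.top_mem _, fun V f _ =>
      N.map f.op (Submodule.subset_span ⟨i, rfl⟩)⟩, fun f => Subtype.ext
        ((SheafOfModules.freeSection (R := R) i).property f)⟩
  -- Each generator lies in the saturated span, so the universal property of the free module makes
  -- its identity factor through the saturation.
  let g : M ⟶ saturation M N := (SheafOfModules.freeHomEquiv _).symm σ
  have hg : g ≫ saturationι M N = 𝟙 M := by
    refine (SheafOfModules.freeHomEquiv _).injective (funext fun i => ?_)
    rw [SheafOfModules.freeHomEquiv_comp_apply, Equiv.apply_symm_apply]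
    rfl
  have : Epi (g ≫ saturationι M N) := by rw [hg]; infer_instance
  exact locally_mem_of_epi M N g U s

lemma eq_of_locally_eq (M : SheafOfModules.{u} R) {U : C} {s t : M.val.obj (op U)} {S : Sieve U}
    (hS : S ∈ J U) (h : ∀ ⦃V : C⦄ (g : V ⟶ U), S g →
      M.val.restrictₛₗ g.op s = M.val.restrictₛₗ g.op t) : s = t :=
  M.isSheaf.isSeparated _ S hS _ _ fun _ g hg => h g hg

/-- Two morphisms out of `B` that agree on the image of `f` agree locally, hence agree, since their
target is separated. So `f` is epi as well as mono, and the category is balanced. -/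
lemma isIso_of_injective_of_locally_surjective {A B : SheafOfModules.{u} R} (f : A ⟶ B)
    (hf : ∀ U : C, Function.Injective (f.val.app (op U)))
    (hf' : ∀ (U : C) (s : B.val.obj (op U)), ∃ S ∈ J U, ∀ ⦃V : C⦄ (g : V ⟶ U), S g →
      ∃ a : A.val.obj (op V), f.val.app (op V) a = B.val.restrictₛₗ g.op s) : IsIso f := by
  have : Mono f := (SheafOfModules.forget R).mono_of_mono_map
    (PresheafOfModules.mono_of_injective fun U => hf U.unop)
  have : Epi f := by
    refine ⟨fun {Z} g h e => ?_⟩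
    ext U s
    obtain ⟨S, hS, hs⟩ := hf' U.unop s
    refine eq_of_locally_eq Z hS fun V i hi => ?_
    obtain ⟨a, ha⟩ := hs i hi
    have h₁ := PresheafOfModules.naturality_apply g.val i.op s
    have h₂ := PresheafOfModules.naturality_apply h.val i.op s
    refine h₁.symm.trans (Eq.trans ?_ h₂)
    have : B.val.map i.op s = f.val.app (op V) a := ha.symm
    rw [this]
    exact congrArg (fun φ : A ⟶ Z => φ.val.app (op V) a) e
  exact isIso_of_mono_of_epi f

/-- A monomorphism is the kernel of its cokernel. The subsheaf of sections killed by the projection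
therefore maps into `A`, and the preimage exists over `U` itself and not only locally. -/
lemma exists_of_cokernel_π_eq_zero {A B : SheafOfModules.{u} R} (f : A ⟶ B) [Mono f] (U : C)
    (s : B.val.obj (op U)) (hs : (cokernel.π f).val.app (op U) s = 0) :
    ∃ a : A.val.obj (op U), f.val.app (op U) a = s := by
  let N : B.val.Submodule :=
    { obj U := LinearMap.ker ((cokernel.π f).val.app U).hom
      map := by
        intro U V g a ha
        refine (PresheafOfModules.naturality_apply (cokernel.π f).val g a).trans ?_
        rw [show (cokernel.π f).val.app U a = 0 from ha]
        exact map_zero _ }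
  have h : saturationι B N ≫ cokernel.π f = 0 := by
    ext V a
    obtain ⟨a, S, hS, ha⟩ := a
    refine eq_of_locally_eq _ hS fun W i hi => ?_
    refine (PresheafOfModules.naturality_apply (cokernel.π f).val i.op a).symm.trans ?_
    refine (ha i hi).trans ?_
    exact (map_zero ((cokernel f).val.restrictₛₗ i.op)).symm
  let g : saturation B N ⟶ A := (Abelian.monoIsKernelOfCokernel _ (cokernelIsCokernel f)).lift
    (KernelFork.ofι _ h)
  have hg : g ≫ f = saturationι B N :=
    (Abelian.monoIsKernelOfCokernel _ (cokernelIsCokernel f)).fac (KernelFork.ofι _ h)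
      WalkingParallelPair.zero
  have hs' : s ∈ (locallyMem B N).obj (op U) := ⟨⊤, J.top_mem _, fun V i _ => N.map i.op hs⟩
  refine ⟨g.val.app (op U) ⟨s, hs'⟩, ?_⟩
  exact congrArg (fun φ : saturation B N ⟶ B => φ.val.app (op U) ⟨s, hs'⟩) hg

lemma freeSection_eq {M : SheafOfModules.{u} R} {I : Type u} (f : SheafOfModules.free I ⟶ M)
    (i : I) (U : Cᵒᵖ) (r : R.obj.obj U) :
    (SheafOfModules.ιFree i ≫ f).val.app U r = r • sectionAt (M.freeHomEquiv f i) U := by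
  have : r = r • (1 : R.obj.obj U) := (mul_one r).symm
  conv_lhs => rw [this]
  exact ((SheafOfModules.ιFree i ≫ f).val.app U).hom.map_smul r (1 : R.obj.obj U)

/-- If a sheaf of modules is free on a finite family of sections, then these sections restrict to
bases of the modules of sections. -/
lemma exists_basis_of_isIso {M : SheafOfModules.{u} R} (σ : M.GeneratingSections) [Finite σ.I]
    [IsIso σ.π] (U : Cᵒᵖ) :
    ∃ b : Module.Basis σ.I (R.obj.obj U) (M.val.obj U), ∀ k, b k = sectionAt (σ.s k) U := by
  classical
  have := Fintype.ofFinite σ.I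
  -- The coordinates `ξ k` and the inclusions `η k` satisfy the identities of a finite direct sum.
  -- These identities hold on sections over each `U`, with no refinement of a cover; finiteness of
  -- `σ.I` is what makes the sum of the `ξ k ≫ η k` meaningful.
  let p (k : σ.I) : SheafOfModules.free σ.I ⟶ SheafOfModules.unit R :=
    Sigma.π (fun _ : σ.I => SheafOfModules.unit R) k
  let ξ (k : σ.I) : M ⟶ SheafOfModules.unit R := inv σ.π ≫ p k
  let η (k : σ.I) : SheafOfModules.unit R ⟶ M := SheafOfModules.ιFree k ≫ σ.π
  have hη (k : σ.I) (r : R.obj.obj U) : (η k).val.app U r = r • sectionAt (σ.s k) U := by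
    rw [freeSection_eq, Equiv.apply_symm_apply]
  have hηξ (k l : σ.I) : η k ≫ ξ l = if k = l then 𝟙 _ else 0 := by
    have : η k ≫ ξ l = SheafOfModules.ιFree k ≫ p l := by simp [η, ξ]
    refine this.trans ?_
    refine (Sigma.ι_π (fun _ : σ.I => SheafOfModules.unit R) k l).trans ?_
    split_ifs <;> rfl
  have hξη : ∑ k, ξ k ≫ η k = 𝟙 M := by
    rw [← cancel_epi σ.π]
    refine Sigma.hom_ext _ _ fun l => ?_
    change SheafOfModules.ιFree l ≫ _ = SheafOfModules.ιFree l ≫ _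
    rw [Category.comp_id, Preadditive.comp_sum, Preadditive.comp_sum]
    have (k : σ.I) : SheafOfModules.ιFree l ≫ σ.π ≫ ξ k ≫ η k = (η l ≫ ξ k) ≫ η k := by
      simp [η]
    simp only [this, hηξ]
    rw [Finset.sum_eq_single l (fun k _ hk => by rw [if_neg hk.symm, zero_comp]) (by simp)]
    simp [η]
  have hsum
      (m : M.val.obj U) : ∑ k, (show R.obj.obj U from (ξ k).val.app U m) • sectionAt (σ.s k) U =
        m := by
    have h : ∀ s : Finset σ.I, (∑ k ∈ s, ξ k ≫ η k).val.app U m =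
        ∑ k ∈ s, (η k).val.app U ((ξ k).val.app U m) := by
      intro s
      induction s using Finset.induction_on with
      | empty => rfl
      | insert k s hk ih => rw [Finset.sum_insert hk, Finset.sum_insert hk, ← ih]; rfl
    refine (Finset.sum_congr rfl fun k _ => (hη k _).symm).trans ((h Finset.univ).symm.trans ?_)
    rw [hξη]
    rfl
  have hδ (k l : σ.I) (r : R.obj.obj U) :
      (ξ l).val.app U (r • sectionAt (σ.s k) U) = if k = l then r else 0 := by
    rw [← hη]
    change (η k ≫ ξ l).val.app U r = _
    rw [hηξ]
    split_ifs <;> rfl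
  let e : M.val.obj U ≃ₗ[R.obj.obj U] (σ.I → R.obj.obj U) :=
    { toFun m k := (ξ k).val.app U m
      map_add' a b := funext fun k => map_add ((ξ k).val.app U).hom a b
      map_smul' r a := funext fun k => ((ξ k).val.app U).hom.map_smul r a
      invFun c := ∑ k, c k • sectionAt (σ.s k) U
      left_inv := hsum
      right_inv c := by
        ext l
        refine (map_sum ((ξ l).val.app U).hom _ _).trans ?_
        refine (Finset.sum_congr rfl fun k _ => hδ k l (c k)).trans ?_
        exact (Finset.sum_ite_eq' _ _ _).trans (if_pos (Finset.mem_univ l)) }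
  refine ⟨Module.Basis.ofEquivFun e, fun k => ?_⟩
  rw [Module.Basis.coe_ofEquivFun]
  change ∑ l, (Pi.single k (1 : R.obj.obj U) : σ.I → R.obj.obj U) l • sectionAt (σ.s l) U = _
  rw [Finset.sum_eq_single k (fun l _ hl => by rw [Pi.single_eq_of_ne hl, zero_smul]) (by simp),
    Pi.single_eq_same, one_smul]

end Site

/-! ### Powers of a generated sheaf of ideals, described locally -/

section LocalPower

variable {X : TopCat.{u}}

/-- Restriction of sections of a presheaf of rings. -/
def pres (P : (Opens X)ᵒᵖ ⥤ RingCat.{u}) {U V : Opens X} (h : V ≤ U) :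
    P.obj (op U) →+* P.obj (op V) :=
  (P.map (homOfLE h).op).hom

lemma pres_pres (P : (Opens X)ᵒᵖ ⥤ RingCat.{u}) {U V W : Opens X} (h : V ≤ U) (h' : W ≤ V)
    (s : P.obj (op U)) : pres P h' (pres P h s) = pres P (h'.trans h) s := by
  change ((P.map (homOfLE h).op) ≫ (P.map (homOfLE h').op)).hom s = _
  rw [← P.map_comp]
  rfl

variable {S : Sheaf (Opens.grothendieckTopology X) RingCat.{u}}

lemma res_res {U V W : Opens X} (h : V ≤ U) (h' : W ≤ V)
    (s : S.obj.obj (op U)) : res S h' (res S h s) = res S (h'.trans h) s :=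
  pres_pres S.obj h h' s

lemma eq_of_locally_res_eq {U : Opens X} {s t : S.obj.obj (op U)}
    (h : ∀ x ∈ U, ∃ (V : Opens X) (hV : V ≤ U), x ∈ V ∧ res S hV s = res S hV t) : s = t := by
  choose V hV hx hV' using fun x : U => h x.1 x.2
  have := (TopCat.Presheaf.isSheaf_iff_isSheafUniqueGluing.{u} (X := X)
      (S.obj : TopCat.Presheaf RingCat.{u} X)).1 S.property
  exact TopCat.Sheaf.eq_of_locally_eq' (X := X) (C := RingCat.{u}) S V U
    (fun x => homOfLE (hV x)) (fun x hx' => Opens.mem_iSup.2 ⟨⟨x, hx'⟩, hx ⟨x, hx'⟩⟩) s t hV'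

/-- Gluing of sections that are determined by a relation. -/
lemma exists_glue {U : Opens X} (r : ∀ V : Opens X, V ≤ U → S.obj.obj (op V) → Prop)
    (hres : ∀ (V W : Opens X) (hV : V ≤ U) (hW : W ≤ V) (s), r V hV s →
      r W (hW.trans hV) (res S hW s))
    (huniq : ∀ (V : Opens X) (hV : V ≤ U) (s t), r V hV s → r V hV t → s = t)
    (hex : ∀ x ∈ U, ∃ (V : Opens X) (hV : V ≤ U), x ∈ V ∧ ∃ s, r V hV s) :
    ∃ s : S.obj.obj (op U), ∀ x ∈ U, ∃ (V : Opens X) (hV : V ≤ U), x ∈ V ∧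
      r V hV (res S hV s) := by
  choose V hV hx t ht using fun x : U => hex x.1 x.2
  obtain ⟨s, hs, -⟩ := TopCat.Sheaf.existsUnique_gluing' (X := X) (C := RingCat.{u}) S V U
    (fun x => homOfLE (hV x)) (fun x hx' => Opens.mem_iSup.2 ⟨⟨x, hx'⟩, hx ⟨x, hx'⟩⟩) t
    (fun x y => huniq _ (inf_le_left.trans (hV x)) _ _
      (hres _ _ (hV x) inf_le_left _ (ht x)) (hres _ _ (hV y) inf_le_right _ (ht y)))
  refine ⟨s, fun x hx' => ⟨V ⟨x, hx'⟩, hV _, hx ⟨x, hx'⟩, ?_⟩⟩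
  have : res S (hV ⟨x, hx'⟩) s = t ⟨x, hx'⟩ := hs ⟨x, hx'⟩
  rw [this]
  exact ht _

variable {P : (Opens X)ᵒᵖ ⥤ RingCat.{u}} (q : P ⟶ S.obj)

/-- The ring homomorphism on sections over `U`. -/
def onSections (U : Opens X) : P.obj (op U) →+* S.obj.obj (op U) := (q.app (op U)).hom

lemma res_onSections {U V : Opens X} (h : V ≤ U) (t : P.obj (op U)) :
    res S h (onSections q U t) = onSections q V (pres P h t) :=
  (NatTrans.naturality_apply q (homOfLE h).op t).symm

lemma exists_local_lift [Presheaf.IsLocallySurjective (Opens.grothendieckTopology X) q]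
    {U : Opens X} (s : S.obj.obj (op U)) {x : X} (hx : x ∈ U) :
    ∃ (V : Opens X) (h : V ≤ U), x ∈ V ∧ ∃ t, onSections q V t = res S h s := by
  obtain ⟨V, f, ⟨t, ht⟩, hV⟩ :=
    Presheaf.imageSieve_mem (Opens.grothendieckTopology X) q (U := op U) s x hx
  exact ⟨V, f.le, hV, t, ht⟩

lemma exists_local_eq [Presheaf.IsLocallyInjective (Opens.grothendieckTopology X) q]
    {U : Opens X} {s t : P.obj (op U)} (hst : onSections q U s = onSections q U t) {x : X}
    (hx : x ∈ U) : ∃ (V : Opens X) (h : V ≤ U), x ∈ V ∧ pres P h s = pres P h t := by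
  obtain ⟨V, f, hf, hV⟩ :=
    Presheaf.equalizerSieve_mem (Opens.grothendieckTopology X) q (X := op U) s t hst x hx
  exact ⟨V, f.le, hV, hf⟩

variable (C : ∀ U : Opens X, Set (P.obj (op U)))

/-- The list `l` accumulates factors from `K`, which turns the nested products `a * c * d` that
define `idealPower` into the lists that define `pow`. The case of the empty list is the one needed.
-/
lemma list_prod_mul_mem_pow {U : Opens X} {K : IdealSheaf S}
    (hK : ∀ c ∈ C U, onSections q U c ∈ K.obj U) {p : ℕ} {t : P.obj (op U)}
    (ht : t ∈ idealPower (C U) p) (l : List (S.obj.obj (op U))) (hl : ∀ a ∈ l, a ∈ K.obj U) :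
    l.prod * onSections q U t ∈ (K.pow (l.length + p)).obj U := by
  induction p generalizing t l with
  | zero =>
    exact (K.pow _).obj U |>.mul_mem_right _ _
      (IdealSheaf.mem_generate.2 fun I hI => hI U _ ⟨l, rfl, hl, rfl⟩)
  | succ p ih =>
    induction ht using AddSubgroup.closure_induction with
    | mem x hx =>
      obtain ⟨a, c, hc, d, hd, rfl⟩ := hx
      -- The product `a * c` counts as a single new factor from `K`.
      have := ih hd (l ++ [onSections q U a * onSections q U c]) (by
        simp only [List.mem_append, List.mem_singleton]
        rintro b (hb | rfl)
        exacts [hl b hb, (K.obj U).mul_mem_left _ _ (hK c hc)])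
      rw [List.prod_append, List.prod_singleton, List.length_append, List.length_singleton,
        add_assoc, add_comm 1 p] at this
      rw [map_mul, map_mul]
      simpa only [mul_assoc] using this
    | zero => simp
    | add x y _ _ hx hy => rw [map_add, mul_add]; exact TwoSidedIdeal.add_mem _ hx hy
    | neg x _ hx => rw [map_neg, mul_neg]; exact TwoSidedIdeal.neg_mem _ hx

/-- The sheaf of two-sided ideals generated by the images of `C`. -/
abbrev generatedIdeal : IdealSheaf S := IdealSheaf.generate fun U => onSections q U '' C U

variable [Presheaf.IsLocallySurjective (Opens.grothendieckTopology X) q]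

section

variable (hC : ∀ {U V : Opens X} (h : V ≤ U), ∀ c ∈ C U, pres P h c ∈ C V)

/-- Sections that are locally images of elements of the `p`-th power of the ideal generated
by `C`. -/
def localPower (p : ℕ) : IdealSheaf S where
  obj U := TwoSidedIdeal.mk' {s | ∀ x ∈ U, ∃ (V : Opens X) (h : V ≤ U), x ∈ V ∧
      ∃ t ∈ idealPower (C V) p, onSections q V t = res S h s}
    (fun x hx => ⟨U, le_rfl, hx, 0, zero_mem _, by simp⟩)
    (fun {s t} hs ht x hx => by
      obtain ⟨V, h, hV, a, ha, ha'⟩ := hs x hx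
      obtain ⟨W, h', hW, b, hb, hb'⟩ := ht x hx
      refine ⟨V ⊓ W, inf_le_left.trans h, ⟨hV, hW⟩, pres P inf_le_left a + pres P inf_le_right b,
        add_mem (map_mem_idealPower _ (hC _) ha) (map_mem_idealPower _ (hC _) hb), ?_⟩
      rw [map_add, map_add, ← res_onSections, ← res_onSections, ha', hb', res_res, res_res])
    (fun {s} hs x hx => by
      obtain ⟨V, h, hV, a, ha, ha'⟩ := hs x hx
      exact ⟨V, h, hV, -a, neg_mem ha, by rw [map_neg, map_neg, ha']⟩)
    (fun {s t} ht x hx => by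
      obtain ⟨V, h, hV, a, ha⟩ := exists_local_lift q s hx
      obtain ⟨W, h', hW, b, hb, hb'⟩ := ht x hx
      refine ⟨V ⊓ W, inf_le_left.trans h, ⟨hV, hW⟩, pres P inf_le_left a * pres P inf_le_right b,
        mul_mem_idealPower_left _ (map_mem_idealPower _ (hC _) hb), ?_⟩
      rw [map_mul, map_mul, ← res_onSections, ← res_onSections, ha, hb', res_res, res_res])
    (fun {s t} hs x hx => by
      obtain ⟨V, h, hV, a, ha⟩ := exists_local_lift q t hx
      obtain ⟨W, h', hW, b, hb, hb'⟩ := hs x hx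
      refine ⟨V ⊓ W, inf_le_left.trans h, ⟨hV, hW⟩, pres P inf_le_right b * pres P inf_le_left a,
        mul_mem_idealPower_right (map_mem_idealPower _ (hC _) hb) _, ?_⟩
      rw [map_mul, map_mul, ← res_onSections, ← res_onSections, ha, hb', res_res, res_res])
  res_mem {U V} h s hs := by
    rw [TwoSidedIdeal.mem_mk'] at hs ⊢
    intro x hx
    obtain ⟨W, h', hW, a, ha, ha'⟩ := hs x (h hx)
    refine ⟨W ⊓ V, inf_le_right, ⟨hW, hx⟩, pres P inf_le_left a,
      map_mem_idealPower _ (hC _) ha, ?_⟩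
    rw [← res_onSections, ha', res_res, res_res]
  of_local U s hs := by
    rw [TwoSidedIdeal.mem_mk']
    intro x hx
    obtain ⟨V, h, hV, hs⟩ := hs x hx
    rw [TwoSidedIdeal.mem_mk'] at hs
    obtain ⟨W, h', hW, a, ha, ha'⟩ := hs x hV
    exact ⟨W, h'.trans h, hW, a, ha, by rw [ha', res_res]⟩

lemma mem_localPower {p : ℕ} {U : Opens X} {s : S.obj.obj (op U)} :
    s ∈ (localPower q C hC p).obj U ↔ ∀ x ∈ U, ∃ (V : Opens X) (h : V ≤ U), x ∈ V ∧
      ∃ t ∈ idealPower (C V) p, onSections q V t = res S h s := by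
  rw [localPower, TwoSidedIdeal.mem_mk', Set.mem_ofPred_eq]

lemma mul_mem_localPower {m n : ℕ} {U : Opens X} {s t : S.obj.obj (op U)}
    (hs : s ∈ (localPower q C hC m).obj U) (ht : t ∈ (localPower q C hC n).obj U) :
    s * t ∈ (localPower q C hC (m + n)).obj U := by
  rw [mem_localPower] at hs ht ⊢
  intro x hx
  obtain ⟨V, h, hV, a, ha, ha'⟩ := hs x hx
  obtain ⟨W, h', hW, b, hb, hb'⟩ := ht x hx
  refine ⟨V ⊓ W, inf_le_left.trans h, ⟨hV, hW⟩, pres P inf_le_left a * pres P inf_le_right b,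
    mul_mem_idealPower (map_mem_idealPower _ (hC _) ha) (map_mem_idealPower _ (hC _) hb), ?_⟩
  rw [map_mul, map_mul, ← res_onSections, ← res_onSections, ha', hb', res_res, res_res]

end

/-- One inclusion is minimality: `localPower` is a sheaf of ideals and is multiplicative in the
exponent, so it contains all products of `p` sections. The other is local and follows from
`list_prod_mul_mem_pow`. -/
lemma mem_pow_generatedIdeal (hC : ∀ {U V : Opens X} (h : V ≤ U), ∀ c ∈ C U, pres P h c ∈ C V)
    {p : ℕ} {U : Opens X} {s : S.obj.obj (op U)} :
    s ∈ ((generatedIdeal q C).pow p).obj U ↔ ∀ x ∈ U, ∃ (V : Opens X) (h : V ≤ U), x ∈ V ∧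
      ∃ t ∈ idealPower (C V) p, onSections q V t = res S h s := by
  rw [← mem_localPower q C hC]
  constructor
  · intro hs
    refine IdealSheaf.mem_generate.1 hs _ ?_
    clear hs
    rintro V _ ⟨l, rfl, hl, rfl⟩
    induction l with
    | nil => exact (mem_localPower ..).2 fun x hx =>
        ⟨V, le_rfl, hx, 1, AddSubgroup.mem_top _, by simp⟩
    | cons a l ih =>
      rw [List.prod_cons, List.length_cons, add_comm]
      refine mul_mem_localPower q C hC ?_ (ih fun b hb => hl b (List.mem_cons_of_mem _ hb))
      refine IdealSheaf.mem_generate.1 (hl a List.mem_cons_self) _ ?_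
      rintro W _ ⟨c, hc, rfl⟩
      exact (mem_localPower ..).2 fun x hx => ⟨W, le_rfl, hx, pres P le_rfl c,
        subset_idealPower_one (hC _ c hc), (res_onSections q le_rfl c).symm⟩
  · intro hs
    refine ((generatedIdeal q C).pow p).of_local U s fun x hx => ?_
    obtain ⟨V, h, hV, t, ht, hts⟩ := (mem_localPower ..).1 hs x hx
    refine ⟨V, h, hV, ?_⟩
    rw [← hts]
    simpa using list_prod_mul_mem_pow q C (K := generatedIdeal q C)
      (fun c hc => IdealSheaf.mem_generate.2 fun I hI => hI V _ ⟨c, hc, rfl⟩) ht [] (by simp)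

lemma mem_generatedIdeal (hC : ∀ {U V : Opens X} (h : V ≤ U), ∀ c ∈ C U, pres P h c ∈ C V)
    {U : Opens X} {s : S.obj.obj (op U)} :
    s ∈ (generatedIdeal q C).obj U ↔ ∀ x ∈ U, ∃ (V : Opens X) (h : V ≤ U), x ∈ V ∧
      ∃ t ∈ idealPower (C V) 1, onSections q V t = res S h s := by
  constructor
  · intro hs
    exact (mem_pow_generatedIdeal q C hC).1
      (IdealSheaf.mem_generate.2 fun I hI => hI U _ ⟨[s], rfl, by simpa using hs, by simp⟩)
  · intro hs
    refine IdealSheaf.mem_generate.1 ((mem_pow_generatedIdeal q C hC).2 hs) _ ?_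
    rintro V _ ⟨l, hl, hl', rfl⟩
    obtain ⟨a, rfl⟩ := List.length_eq_one_iff.1 hl
    simpa using hl' a

end LocalPower

/-! ### Balanced tensor products -/

section BalancedTensor

variable {R N L A : Type u} [Ring R] [AddCommGroup N] [Module Rᵐᵒᵖ N] [AddCommGroup L] [Module R L]
  [AddCommGroup A]

/-- The map `l ↦ n ⊗ l`. -/
def tmulHom (R : Type u) {N L : Type u} [Ring R] [AddCommGroup N] [Module Rᵐᵒᵖ N]
    [AddCommGroup L] [Module R L] (n : N) : L →+ BalancedTensor R N L :=
  (QuotientAddGroup.mk' (balancedRel R N L)).comp (TensorProduct.mk ℤ N L n).toAddMonoidHom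

lemma tmul_add_left (n n' : N) (l : L) : BalancedTensor.tmul R (n + n') l =
    BalancedTensor.tmul R n l + BalancedTensor.tmul R n' l :=
  congrArg QuotientAddGroup.mk (TensorProduct.add_tmul n n' l)

lemma tmul_zero_left (l : L) : BalancedTensor.tmul R (0 : N) l = 0 :=
  congrArg QuotientAddGroup.mk (TensorProduct.zero_tmul N l)

lemma tmul_smul_left (r : R) (n : N) (l : L) : BalancedTensor.tmul R (MulOpposite.op r • n) l =
    BalancedTensor.tmul R n (r • l) := by
  refine QuotientAddGroup.eq_iff_sub_mem.2 (AddSubgroup.subset_closure ⟨r, n, l, rfl⟩)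

lemma balancedTensor_induction {p : BalancedTensor R N L → Prop} (h₀ : p 0)
    (hadd : ∀ a b, p a → p b → p (a + b)) (htmul : ∀ n l, p (BalancedTensor.tmul R n l))
    (z : BalancedTensor R N L) : p z := by
  obtain ⟨y, rfl⟩ := QuotientAddGroup.mk_surjective z
  induction y using TensorProduct.induction_on with
  | zero => exact h₀
  | tmul n l => exact htmul n l
  | add a b ha hb => exact hadd _ _ ha hb

/-- The additive map out of a tensor product given by a balanced map. -/
def balancedLift (f : N →+ L →+ A)
    (hf : ∀ (r : R) n l, f (MulOpposite.op r • n) l = f n (r • l)) :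
    BalancedTensor R N L →+ A :=
  QuotientAddGroup.lift (balancedRel R N L) (TensorProduct.liftAddHom f fun r n l => by simp) (by
    rw [balancedRel, AddSubgroup.closure_le]
    rintro _ ⟨r, n, l, rfl⟩
    simp [hf])

end BalancedTensor

/-! ### Flatness from local frames -/

section Flat

variable {X : TopCat.{u}} {S : Sheaf (Opens.grothendieckTopology X) RingCat.{u}}
  {P : (Opens X)ᵒᵖ ⥤ RingCat.{u}}

/-- Letters over an open set `U`, compatible with restriction, such that the ideal generated by
`C` is a free right module on the values of the blocks. -/
structure Frame (P : (Opens X)ᵒᵖ ⥤ RingCat.{u}) (C : ∀ U : Opens X, Set (P.obj (op U)))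
    (U : Opens X) where
  ι₁ : Type u
  ι₂ : Type u
  x (V : Opens X) (hV : V ≤ U) : ι₁ → P.obj (op V)
  y (V : Opens X) (hV : V ≤ U) : ι₂ → P.obj (op V)
  pres_x {V W : Opens X} (hV : V ≤ U) (hW : W ≤ V) (i : ι₁) :
    pres P hW (x V hV i) = x W (hW.trans hV) i
  pres_y {V W : Opens X} (hV : V ≤ U) (hW : W ≤ V) (j : ι₂) :
    pres P hW (y V hV j) = y W (hW.trans hV) j
  comm_mem (V : Opens X) (hV : V ≤ U) (c : ι₁ × ι₂) : comm (x V hV) (y V hV) c ∈ C V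
  blockSum_injective (V : Opens X) (hV : V ≤ U) :
    Function.Injective (blockSum (x V hV) (y V hV))
  exists_blockSum_eq (V : Opens X) (hV : V ≤ U) {a : P.obj (op V)} (ha : a ∈ idealPower (C V) 1) :
    ∃ f, blockSum (x V hV) (y V hV) f = a

namespace Frame

variable {C : ∀ U : Opens X, Set (P.obj (op U))} {U : Opens X} (F : Frame P C U)

/-- The value of a block over `V`. -/
def block (V : Opens X) (hV : V ≤ U) (β : Block F.ι₁ F.ι₂) : P.obj (op V) :=
  Block.eval (F.x V hV) (F.y V hV) β

/-- The sum `∑ β * f β` over `V`. -/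
def sum (V : Opens X) (hV : V ≤ U) : (Block F.ι₁ F.ι₂ →₀ P.obj (op V)) →+ P.obj (op V) :=
  blockSum (F.x V hV) (F.y V hV)

lemma pres_comp_x {V W : Opens X} (hV : V ≤ U) (hW : W ≤ V) :
    pres P hW ∘ F.x V hV = F.x W (hW.trans hV) :=
  funext (F.pres_x hV hW)

lemma pres_comp_y {V W : Opens X} (hV : V ≤ U) (hW : W ≤ V) :
    pres P hW ∘ F.y V hV = F.y W (hW.trans hV) :=
  funext (F.pres_y hV hW)

lemma pres_block {V W : Opens X} (hV : V ≤ U) (hW : W ≤ V) (β : Block F.ι₁ F.ι₂) :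
    pres P hW (F.block V hV β) = F.block W (hW.trans hV) β := by
  rw [block, Block.map_eval, pres_comp_x, pres_comp_y]
  rfl

lemma pres_sum {V W : Opens X} (hV : V ≤ U) (hW : W ≤ V) (f : Block F.ι₁ F.ι₂ →₀ P.obj (op V)) :
    pres P hW (F.sum V hV f) = F.sum W (hW.trans hV) (f.mapRange (pres P hW) (map_zero _)) := by
  rw [sum, map_blockSum, pres_comp_x, pres_comp_y]
  rfl

lemma sum_mem (V : Opens X) (hV : V ≤ U) (f : Block F.ι₁ F.ι₂ →₀ P.obj (op V)) :
    F.sum V hV f ∈ idealPower (C V) 1 :=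
  blockSum_mem_idealPower _ _ (F.comm_mem V hV) f

lemma block_mem (V : Opens X) (hV : V ≤ U) (β : Block F.ι₁ F.ι₂) :
    F.block V hV β ∈ idealPower (C V) 1 := by
  simpa [sum, block, blockSum_single] using F.sum_mem V hV (Finsupp.single β 1)

variable (q : P ⟶ S.obj)

/-- `r` is the coefficient of the section `s` at the block `β`. -/
def IsCoeff {W : Opens X} (hW : W ≤ U) (β : Block F.ι₁ F.ι₂) (s r : S.obj.obj (op W)) : Prop :=
  ∀ x ∈ W, ∃ (V : Opens X) (hV : V ≤ W), x ∈ V ∧ ∃ f : Block F.ι₁ F.ι₂ →₀ P.obj (op V),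
    onSections q V (F.sum V (hV.trans hW) f) = res S hV s ∧ onSections q V (f β) = res S hV r

variable {q}

lemma IsCoeff.add {W : Opens X} {hW : W ≤ U} {β : Block F.ι₁ F.ι₂} {s s' r r' : S.obj.obj (op W)}
    (h : F.IsCoeff q hW β s r) (h' : F.IsCoeff q hW β s' r') :
    F.IsCoeff q hW β (s + s') (r + r') := by
  intro x hx
  obtain ⟨V, hV, hxV, f, hf, hfr⟩ := h x hx
  obtain ⟨V', hV', hxV', f', hf', hfr'⟩ := h' x hx
  refine ⟨V ⊓ V', inf_le_left.trans hV, ⟨hxV, hxV'⟩,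
    f.mapRange (pres P inf_le_left) (map_zero _) + f'.mapRange (pres P inf_le_right) (map_zero _),
    ?_, ?_⟩
  · rw [map_add, ← F.pres_sum (hV.trans hW), ← F.pres_sum (hV'.trans hW), map_add,
      ← res_onSections, ← res_onSections, hf, hf', res_res, res_res, map_add]
  · rw [Finsupp.add_apply, Finsupp.mapRange_apply, Finsupp.mapRange_apply, map_add,
      ← res_onSections, ← res_onSections, hfr, hfr', res_res, res_res, map_add]

/-- Blocks stand on the left, so right multiplication acts on the coefficients alone; this makes the
coefficients right linear. -/
lemma IsCoeff.mul [Presheaf.IsLocallySurjective (Opens.grothendieckTopology X) q]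
    {W : Opens X} {hW : W ≤ U} {β : Block F.ι₁ F.ι₂} {s r : S.obj.obj (op W)}
    (h : F.IsCoeff q hW β s r) (t : S.obj.obj (op W)) : F.IsCoeff q hW β (s * t) (r * t) := by
  intro x hx
  obtain ⟨V, hV, hxV, f, hf, hfr⟩ := h x hx
  obtain ⟨V', hV', hxV', a, ha⟩ := exists_local_lift q t hx
  refine ⟨V ⊓ V', inf_le_left.trans hV, ⟨hxV, hxV'⟩,
    (f.mapRange (pres P inf_le_left) (map_zero _)).mapRange (· * pres P inf_le_right a)
      (zero_mul _), ?_, ?_⟩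
  · rw [sum, ← blockSum_mul, ← sum, ← F.pres_sum (hV.trans hW), map_mul,
      ← res_onSections, ← res_onSections, hf, ha, res_res, res_res, map_mul]
  · rw [Finsupp.mapRange_apply, Finsupp.mapRange_apply, map_mul,
      ← res_onSections, ← res_onSections, hfr, ha, res_res, res_res, map_mul]

variable [Presheaf.IsLocallyInjective (Opens.grothendieckTopology X) q]

/-- Equal images under `q` mean equality in `P` only after shrinking, so uniqueness of the expansion
is used over the smaller open sets, where the frame provides it too. -/
lemma coeff_eq {V : Opens X} (hV : V ≤ U) {f f' : Block F.ι₁ F.ι₂ →₀ P.obj (op V)}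
    (h : onSections q V (F.sum V hV f) = onSections q V (F.sum V hV f')) (β : Block F.ι₁ F.ι₂) :
    onSections q V (f β) = onSections q V (f' β) := by
  refine eq_of_locally_res_eq fun x hx => ?_
  obtain ⟨W, hW, hxW, e⟩ := exists_local_eq q h hx
  refine ⟨W, hW, hxW, ?_⟩
  rw [F.pres_sum, F.pres_sum] at e
  have := DFunLike.congr_fun (F.blockSum_injective W (hW.trans hV) e) β
  rw [Finsupp.mapRange_apply, Finsupp.mapRange_apply] at this
  rw [res_onSections, res_onSections, this]

lemma IsCoeff.eq {W : Opens X} {hW : W ≤ U} {β : Block F.ι₁ F.ι₂} {s r r' : S.obj.obj (op W)}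
    (h : F.IsCoeff q hW β s r) (h' : F.IsCoeff q hW β s r') : r = r' := by
  refine eq_of_locally_res_eq fun x hx => ?_
  obtain ⟨V, hV, hxV, f, hf, hfr⟩ := h x hx
  obtain ⟨V', hV', hxV', f', hf', hfr'⟩ := h' x hx
  refine ⟨V ⊓ V', inf_le_left.trans hV, ⟨hxV, hxV'⟩, ?_⟩
  have := F.coeff_eq (q := q) (V := V ⊓ V') (inf_le_left.trans (hV.trans hW))
    (f := f.mapRange (pres P inf_le_left) (map_zero _))
    (f' := f'.mapRange (pres P inf_le_right) (map_zero _)) (by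
      rw [← F.pres_sum (hV.trans hW), ← F.pres_sum (hV'.trans hW), ← res_onSections,
        ← res_onSections, hf, hf', res_res, res_res]) β
  rw [Finsupp.mapRange_apply, Finsupp.mapRange_apply, ← res_onSections, ← res_onSections, hfr,
    hfr', res_res, res_res] at this
  exact this

variable [Presheaf.IsLocallySurjective (Opens.grothendieckTopology X) q]

/-- Expansions in blocks exist locally, and by uniqueness their coefficients at a fixed `β` glue.
Each `β` is treated separately, since the glued coefficients need not be finitely many nonzero ones
over all of `W`. -/
lemma exists_isCoeff (hC : ∀ {U V : Opens X} (h : V ≤ U), ∀ c ∈ C U, pres P h c ∈ C V)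
    {W : Opens X} (hW : W ≤ U) (β : Block F.ι₁ F.ι₂) {s : S.obj.obj (op W)}
    (hs : s ∈ (generatedIdeal q C).obj W) : ∃ r, F.IsCoeff q hW β s r := by
  obtain ⟨r, hr⟩ := exists_glue (S := S) (U := W)
    (fun V hV r => ∃ f : Block F.ι₁ F.ι₂ →₀ P.obj (op V),
      onSections q V (F.sum V (hV.trans hW) f) = res S hV s ∧ onSections q V (f β) = r)
    (by
      rintro V V' hV hV' _ ⟨f, hf, rfl⟩
      refine ⟨f.mapRange (pres P hV') (map_zero _), ?_, ?_⟩
      · rw [← F.pres_sum (hV.trans hW), ← res_onSections, hf, res_res]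
      · rw [Finsupp.mapRange_apply, res_onSections])
    (by
      rintro V hV _ _ ⟨f, hf, rfl⟩ ⟨f', hf', rfl⟩
      exact F.coeff_eq _ (hf.trans hf'.symm) β)
    (by
      intro x hx
      obtain ⟨V, hV, hxV, t, ht, hts⟩ := (mem_generatedIdeal q C hC).1 hs x hx
      obtain ⟨f, rfl⟩ := F.exists_blockSum_eq V (hV.trans hW) ht
      exact ⟨V, hV, hxV, _, f, hts, rfl⟩)
  exact ⟨r, hr⟩

end Frame

/-- A section of a sheaf of two-sided ideals as a section of the right module. -/
def rightElem {I : IdealSheaf S} {U : Opens X} (s : S.obj.obj (op U)) (hs : s ∈ I.obj U) :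
    I.toRightModule.val.obj (op U) :=
  ⟨MulOpposite.op s, hs⟩

/-- The section of the ring that underlies a section of the right module. -/
def rightVal {I : IdealSheaf S} {U : Opens X} (n : I.toRightModule.val.obj (op U)) :
    S.obj.obj (op U) :=
  MulOpposite.unop n.1

lemma rightVal_mem {I : IdealSheaf S} {U : Opens X} (n : I.toRightModule.val.obj (op U)) :
    rightVal n ∈ I.obj U := n.2

lemma rightVal_injective {I : IdealSheaf S} {U : Opens X} :
    Function.Injective (rightVal (I := I) (U := U)) :=
  fun _ _ h => Subtype.ext (MulOpposite.unop_injective h)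

lemma rightVal_rightElem {I : IdealSheaf S} {U : Opens X} {s : S.obj.obj (op U)}
    (hs : s ∈ I.obj U) : rightVal (rightElem s hs) = s := rfl

lemma rightVal_smul {I : IdealSheaf S} {U : Opens X} (r : S.obj.obj (op U))
    (n : I.toRightModule.val.obj (op U)) :
    rightVal (MulOpposite.op r • n) = rightVal n * r := rfl

lemma rightVal_restrict {I : IdealSheaf S} {U V : Opens X} (h : V ≤ U)
    (n : I.toRightModule.val.obj (op U)) :
    rightVal (I.toRightModule.val.restrictₛₗ (homOfLE h).op n) = res S h (rightVal n) := rfl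

section

variable (L : SheafOfModules.{u} S)

/-- Restriction of sections of the tensor product. -/
def tensorRes (N : SheafOfModules.{u} (opSheaf S)) {V W : Opens X} (h : W ≤ V) :
    BalancedTensor (S.obj.obj (op V)) (N.val.obj (op V)) (L.val.obj (op V)) →+
      BalancedTensor (S.obj.obj (op W)) (N.val.obj (op W)) (L.val.obj (op W)) :=
  ((tensorPresheaf N L).map (homOfLE h).op).hom

lemma tensorRes_tmul (N : SheafOfModules.{u} (opSheaf S)) {V W : Opens X} (h : W ≤ V)
    (n : N.val.obj (op V)) (l : L.val.obj (op V)) :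
    tensorRes L N h (BalancedTensor.tmul _ n l) = BalancedTensor.tmul _
      (N.val.restrictₛₗ (homOfLE h).op n) (L.val.restrictₛₗ (homOfLE h).op l) := rfl

lemma tensorRes_tensorRes (N : SheafOfModules.{u} (opSheaf S)) {U V W : Opens X} (h : V ≤ U)
    (h' : W ≤ V) (z : BalancedTensor (S.obj.obj (op U)) (N.val.obj (op U)) (L.val.obj (op U))) :
    tensorRes L N h' (tensorRes L N h z) = tensorRes L N (h'.trans h) z := by
  change ((tensorPresheaf N L).map (homOfLE h).op ≫ (tensorPresheaf N L).map (homOfLE h').op).hom z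
    = _
  rw [← Functor.map_comp]
  rfl

/-- The map on sections of the tensor product induced by a morphism of modules. -/
def tensorApp {L L' : SheafOfModules.{u} S} (N : SheafOfModules.{u} (opSheaf S)) (φ : L ⟶ L')
    (W : Opens X) :
    BalancedTensor (S.obj.obj (op W)) (N.val.obj (op W)) (L.val.obj (op W)) →+
      BalancedTensor (S.obj.obj (op W)) (N.val.obj (op W)) (L'.val.obj (op W)) :=
  ((tensorPresheafMap N φ).app (op W)).hom

lemma tensorRes_tensorApp {L L' : SheafOfModules.{u} S} (N : SheafOfModules.{u} (opSheaf S))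
    (φ : L ⟶ L') {V W : Opens X} (h : W ≤ V)
    (z : BalancedTensor (S.obj.obj (op V)) (N.val.obj (op V)) (L.val.obj (op V))) :
    tensorApp N φ W (tensorRes L N h z) = tensorRes L' N h (tensorApp N φ V z) :=
  NatTrans.naturality_apply (tensorPresheafMap N φ) (homOfLE h).op z

end

lemma Frame.onSections_block_mem {C : ∀ U : Opens X, Set (P.obj (op U))} {U : Opens X}
    (F : Frame P C U) (q : P ⟶ S.obj)
    [Presheaf.IsLocallySurjective (Opens.grothendieckTopology X) q]
    (hC : ∀ {U V : Opens X} (h : V ≤ U), ∀ c ∈ C U, pres P h c ∈ C V)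
    {W : Opens X} (hW : W ≤ U) (β : Block F.ι₁ F.ι₂) :
    onSections q W (F.block W hW β) ∈ (generatedIdeal q C).obj W :=
  (mem_generatedIdeal q C hC).2 fun _ hx => ⟨W, le_rfl, hx, pres P le_rfl (F.block W hW β),
    map_mem_idealPower _ (hC _) (F.block_mem W hW β), (res_onSections q le_rfl _).symm⟩

namespace Frame

variable {C : ∀ U : Opens X, Set (P.obj (op U))} {U : Opens X} (F : Frame P C U)
  (q : P ⟶ S.obj) [Presheaf.IsLocallySurjective (Opens.grothendieckTopology X) q]
  (hC : ∀ {U V : Opens X} (h : V ≤ U), ∀ c ∈ C U, pres P h c ∈ C V)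

/-- A block as a section of the ideal. -/
def blockElem {W : Opens X} (hW : W ≤ U) (β : Block F.ι₁ F.ι₂) :
    (generatedIdeal q C).toRightModule.val.obj (op W) :=
  rightElem _ (F.onSections_block_mem q hC hW β)

lemma restrict_blockElem {V W : Opens X} (hV : V ≤ U) (hW : W ≤ V) (β : Block F.ι₁ F.ι₂) :
    (generatedIdeal q C).toRightModule.val.restrictₛₗ (homOfLE hW).op (F.blockElem q hC hV β) =
      F.blockElem q hC (hW.trans hV) β :=
  rightVal_injective (by
    rw [rightVal_restrict, blockElem, blockElem, rightVal_rightElem, rightVal_rightElem,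
      res_onSections, pres_block])

section

variable (L : SheafOfModules.{u} S)

/-- The tensor `∑ β ⊗ g β`. -/
def tensorSum {W : Opens X} (hW : W ≤ U) : (Block F.ι₁ F.ι₂ →₀ L.val.obj (op W)) →+
    BalancedTensor (S.obj.obj (op W)) ((generatedIdeal q C).toRightModule.val.obj (op W))
      (L.val.obj (op W)) :=
  Finsupp.liftAddHom fun β => tmulHom _ (F.blockElem q hC hW β)

lemma tensorSum_single {W : Opens X} (hW : W ≤ U) (β : Block F.ι₁ F.ι₂) (l : L.val.obj (op W)) :
    F.tensorSum q hC L hW (Finsupp.single β l) =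
      BalancedTensor.tmul (S.obj.obj (op W)) (F.blockElem q hC hW β) l := by
  exact Finsupp.liftAddHom_apply_single _ _ _

lemma map_tensorSum {V W : Opens X} (hV : V ≤ U) (hW : W ≤ V)
    (g : Block F.ι₁ F.ι₂ →₀ L.val.obj (op V)) :
    tensorRes L (generatedIdeal q C).toRightModule hW (F.tensorSum q hC L hV g) =
      F.tensorSum q hC L (hW.trans hV)
        (g.mapRange (L.val.restrictₛₗ (homOfLE hW).op) (map_zero _)) := by
  induction g using Finsupp.induction_linear with
  | zero => simp
  | add f₁ f₂ h₁ h₂ =>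
    rw [map_add, Finsupp.mapRange_add (map_add _), map_add, map_add, ← h₁, ← h₂]
  | single β l =>
    rw [Finsupp.mapRange_single, tensorSum_single, tensorSum_single,
      ← F.restrict_blockElem q hC hV hW]
    rfl

lemma tensorApp_tensorSum {L L' : SheafOfModules.{u} S} (φ : L ⟶ L') {W : Opens X}
    (hW : W ≤ U) (g : Block F.ι₁ F.ι₂ →₀ L.val.obj (op W)) :
    tensorApp (generatedIdeal q C).toRightModule φ W (F.tensorSum q hC L hW g) =
      F.tensorSum q hC L' hW
        (g.mapRange (φ.val.app (op W)).hom (map_zero _)) := by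
  induction g using Finsupp.induction_linear with
  | zero => simp
  | add f₁ f₂ h₁ h₂ =>
    rw [map_add, Finsupp.mapRange_add (map_add _), map_add, map_add, ← h₁, ← h₂]
  | single β l =>
    rw [Finsupp.mapRange_single, tensorSum_single, tensorSum_single]
    rfl

/-- Near `x` a section `n` of the ideal is a finite sum of terms `β * f β`, so `n ⊗ l` is the sum of
the `β ⊗ (f β • l)`. Shrinking is needed to lift `n` to `P`, and to meet finitely many
neighbourhoods when tensors are added. -/
lemma exists_tensorSum_eq {W : Opens X} {x : X} (hxU : x ∈ U) (hxW : x ∈ W)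
    (z : BalancedTensor (S.obj.obj (op W)) ((generatedIdeal q C).toRightModule.val.obj (op W))
      (L.val.obj (op W))) :
    ∃ (V : Opens X) (hV : V ≤ W) (hVU : V ≤ U), x ∈ V ∧ ∃ g, F.tensorSum q hC L hVU g =
      tensorRes L (generatedIdeal q C).toRightModule hV z := by
  induction z using balancedTensor_induction with
  | h₀ => exact ⟨W ⊓ U, inf_le_left, inf_le_right, ⟨hxW, hxU⟩, 0, by
      rw [map_zero, map_zero]⟩
  | hadd a b ha hb =>
    obtain ⟨V, hV, hVU, hxV, g, hg⟩ := ha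
    obtain ⟨V', hV', hVU', hxV', g', hg'⟩ := hb
    refine ⟨V ⊓ V', inf_le_left.trans hV, inf_le_left.trans hVU, ⟨hxV, hxV'⟩,
      g.mapRange (L.val.restrictₛₗ (homOfLE inf_le_left).op) (map_zero _) +
        g'.mapRange (L.val.restrictₛₗ (homOfLE inf_le_right).op) (map_zero _), ?_⟩
    rw [map_add, ← F.map_tensorSum q hC L hVU, ← F.map_tensorSum q hC L hVU', hg, hg']
    rw [tensorRes_tensorRes, tensorRes_tensorRes, map_add]
  | htmul n l =>
    obtain ⟨V, hV, hxV, t, ht, hts⟩ := (mem_generatedIdeal q C hC).1 (rightVal_mem n) x hxW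
    have hC' : pres P (inf_le_left : V ⊓ U ≤ V) t ∈ idealPower (C (V ⊓ U)) 1 :=
      map_mem_idealPower _ (hC _) ht
    obtain ⟨f, hf⟩ := F.exists_blockSum_eq (V ⊓ U) inf_le_right hC'
    have hf' : onSections q _ (F.sum (V ⊓ U) inf_le_right f) =
        res S (inf_le_left.trans hV) (rightVal n) := by
      rw [sum, hf, ← res_onSections, hts, res_res]
    refine ⟨V ⊓ U, inf_le_left.trans hV, inf_le_right, ⟨hxV, hxU⟩,
      f.mapRange
        (fun a => onSections q _ a • L.val.restrictₛₗ (homOfLE (inf_le_left.trans hV)).op l)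
        (by rw [map_zero, zero_smul]), ?_⟩
    rw [tensorRes_tmul]
    -- From here on only the ring section underlying the restricted `n` matters, so the restriction
    -- becomes a variable over which the induction on `f` can generalize.
    generalize hn : (generatedIdeal q C).toRightModule.val.restrictₛₗ
      (homOfLE (inf_le_left.trans hV)).op n = n'
    have hn' : onSections q _ (F.sum (V ⊓ U) inf_le_right f) = rightVal n' := by
      rw [hf', ← hn]; rfl
    generalize L.val.restrictₛₗ (homOfLE (inf_le_left.trans hV)).op l = l'
    clear hf' hf hn
    induction f using Finsupp.induction_linear generalizing n' with
    | zero =>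
      have : n' = 0 := rightVal_injective (by rw [← hn', map_zero, map_zero]; rfl)
      rw [this, tmul_zero_left, Finsupp.mapRange_zero, map_zero]
    | add f₁ f₂ h₁ h₂ =>
      have hm (f) : onSections q _ (F.sum (V ⊓ U) inf_le_right f) ∈
          (generatedIdeal q C).obj (V ⊓ U) := (mem_generatedIdeal q C hC).2 fun _ hx =>
        ⟨_, le_rfl, hx, _, map_mem_idealPower _ (hC le_rfl) (F.sum_mem _ _ f),
          (res_onSections q le_rfl _).symm⟩
      have : n' = rightElem _ (hm f₁) + rightElem _ (hm f₂) := rightVal_injective (by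
        rw [← hn', map_add, map_add]; rfl)
      rw [this, tmul_add_left, ← h₁ _ rfl, ← h₂ _ rfl, Finsupp.mapRange_add, map_add]
      intro a b
      rw [map_add, add_smul]
    | single β a =>
      rw [Finsupp.mapRange_single, tensorSum_single, ← tmul_smul_left]
      congr 1
      refine rightVal_injective ?_
      rw [rightVal_smul, ← hn', sum, blockSum_single, map_mul]
      rfl

end

variable [Presheaf.IsLocallyInjective (Opens.grothendieckTopology X) q]

/-- The coefficient of a section of the ideal at a block. -/
def coeff {W : Opens X} (hW : W ≤ U) (β : Block F.ι₁ F.ι₂) :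
    (generatedIdeal q C).toRightModule.val.obj (op W) →+ S.obj.obj (op W) :=
  AddMonoidHom.mk' (fun n => (F.exists_isCoeff hC hW β (rightVal_mem n)).choose) fun n n' =>
    IsCoeff.eq F (F.exists_isCoeff hC hW β (rightVal_mem (n + n'))).choose_spec
      (IsCoeff.add F (F.exists_isCoeff hC hW β (rightVal_mem n)).choose_spec
        (F.exists_isCoeff hC hW β (rightVal_mem n')).choose_spec)

lemma isCoeff_coeff {W : Opens X} (hW : W ≤ U) (β : Block F.ι₁ F.ι₂)
    (n : (generatedIdeal q C).toRightModule.val.obj (op W)) :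
    F.IsCoeff q hW β (rightVal n) (F.coeff q hC hW β n) :=
  (F.exists_isCoeff hC hW β (rightVal_mem n)).choose_spec

lemma coeff_smul {W : Opens X} (hW : W ≤ U) (β : Block F.ι₁ F.ι₂) (r : S.obj.obj (op W))
    (n : (generatedIdeal q C).toRightModule.val.obj (op W)) :
    F.coeff q hC hW β (MulOpposite.op r • n) = F.coeff q hC hW β n * r :=
  IsCoeff.eq F (F.isCoeff_coeff q hC hW β _) (IsCoeff.mul F (F.isCoeff_coeff q hC hW β n) r)

lemma coeff_blockElem_self {W : Opens X} (hW : W ≤ U) (β : Block F.ι₁ F.ι₂) :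
    F.coeff q hC hW β (F.blockElem q hC hW β) = 1 := by
  classical
  refine IsCoeff.eq F (F.isCoeff_coeff q hC hW β _) fun x hx =>
    ⟨W, le_rfl, hx, Finsupp.single β 1, ?_, ?_⟩
  · rw [sum, blockSum_single, mul_one, blockElem, rightVal_rightElem, res_onSections, pres_block]
    rfl
  · rw [Finsupp.single_eq_same, map_one, map_one]

lemma coeff_blockElem_of_ne {W : Opens X} (hW : W ≤ U) {β β' : Block F.ι₁ F.ι₂} (h : β' ≠ β) :
    F.coeff q hC hW β (F.blockElem q hC hW β') = 0 := by
  classical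
  refine IsCoeff.eq F (F.isCoeff_coeff q hC hW β _) fun x hx =>
    ⟨W, le_rfl, hx, Finsupp.single β' 1, ?_, ?_⟩
  · rw [sum, blockSum_single, mul_one, blockElem, rightVal_rightElem, res_onSections, pres_block]
    rfl
  · rw [Finsupp.single_eq_of_ne h.symm, map_zero, map_zero]

/-- The coefficient maps are a dual basis: `n ⊗ l ↦ coeff β n • l` is balanced by right linearity of
`coeff`, and it reads off `g β` from the tensor. -/
lemma eq_zero_of_tensorSum_eq_zero (L : SheafOfModules.{u} S) {W : Opens X} (hW : W ≤ U)
    {g : Block F.ι₁ F.ι₂ →₀ L.val.obj (op W)} (hg : F.tensorSum q hC L hW g = 0) : g = 0 := by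
  ext β
  let Φ : BalancedTensor (S.obj.obj (op W)) ((generatedIdeal q C).toRightModule.val.obj (op W))
      (L.val.obj (op W)) →+ L.val.obj (op W) :=
    balancedLift ((smulAddHom (S.obj.obj (op W)) (L.val.obj (op W))).comp (F.coeff q hC hW β))
      fun r n l => by
        simp only [AddMonoidHom.comp_apply, coeff_smul, smulAddHom_apply, mul_smul]
  have h : Φ.comp (F.tensorSum q hC L hW) = Finsupp.applyAddHom β := by
    classical
    refine Finsupp.addHom_ext fun β' l => ?_
    rw [AddMonoidHom.comp_apply, tensorSum_single]
    change F.coeff q hC hW β (F.blockElem q hC hW β') • l = (Finsupp.single β' l) β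
    by_cases hβ : β' = β
    · subst hβ
      rw [coeff_blockElem_self, one_smul, Finsupp.single_eq_same]
    · rw [coeff_blockElem_of_ne F q hC hW hβ, zero_smul, Finsupp.single_eq_of_ne (Ne.symm hβ)]
  have := DFunLike.congr_fun h g
  rw [AddMonoidHom.comp_apply, hg, map_zero] at this
  exact this.symm

end Frame

/-- If the ideal generated by `C` is locally a free right module on the values of blocks, then the
sheaf of ideals generated by `C` is flat as a sheaf of right modules. -/
theorem isFlatRight_of_frames (q : P ⟶ S.obj)
    [Presheaf.IsLocallyInjective (Opens.grothendieckTopology X) q]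
    [Presheaf.IsLocallySurjective (Opens.grothendieckTopology X) q]
    (C : ∀ U : Opens X, Set (P.obj (op U)))
    (hC : ∀ {U V : Opens X} (h : V ≤ U), ∀ c ∈ C U, pres P h c ∈ C V)
    (hF : ∀ x : X, ∃ U : Opens X, x ∈ U ∧ Nonempty (Frame P C U)) :
    IsFlatRight (generatedIdeal q C).toRightModule := by
  refine ⟨fun {L L'} φ hφ => ?_⟩
  have hinj (W : Opens X) : Function.Injective (φ.val.app (op W)) :=
    PresheafOfModules.injective_of_mono ((SheafOfModules.forget S).map φ) (op W)
  have key (W : Opens X) (z : BalancedTensor (S.obj.obj (op W))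
      ((generatedIdeal q C).toRightModule.val.obj (op W)) (L.val.obj (op W)))
      (hz : tensorApp (generatedIdeal q C).toRightModule φ W z = 0) (x : X) (hx : x ∈ W) :
      ∃ (V : Opens X) (hV : V ≤ W), x ∈ V ∧
        tensorRes L (generatedIdeal q C).toRightModule hV z = 0 := by
    obtain ⟨U, hxU, ⟨F⟩⟩ := hF x
    -- Near `x` the tensor is a sum of terms `β ⊗ g β` and `φ` acts on the coefficients; since these
    -- are unique and `φ` is injective on sections, all `g β` vanish.
    obtain ⟨V, hV, hVU, hxV, g, hg⟩ := F.exists_tensorSum_eq q hC L hxU hx z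
    refine ⟨V, hV, hxV, ?_⟩
    have h₁ : F.tensorSum q hC L' hVU (g.mapRange (φ.val.app (op V)).hom (map_zero _)) = 0 := by
      rw [← F.tensorApp_tensorSum, hg, tensorRes_tensorApp, hz, map_zero]
    have h₂ := F.eq_zero_of_tensorSum_eq_zero q hC L' hVU h₁
    have h₃ : g = 0 := Finsupp.mapRange_injective _ (map_zero _) (hinj V) (by
      rw [h₂, Finsupp.mapRange_zero])
    rw [← hg, h₃, map_zero]
  have : Presheaf.IsLocallyInjective (Opens.grothendieckTopology X)
      (tensorPresheafMap (generatedIdeal q C).toRightModule φ) := by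
    refine ⟨fun {W} a b hab x hx => ?_⟩
    obtain ⟨V, hV, hxV, h⟩ := key W.unop (a - b) ((map_sub _ a b).trans (sub_eq_zero.2 hab)) x hx
    exact ⟨V, homOfLE hV, sub_eq_zero.1 ((map_sub (tensorRes L _ hV) a b).symm.trans h), hxV⟩
  -- Local injectivity passes from a map of presheaves to the associated map of sheaves.
  have h : Sheaf.IsLocallyInjective ((tensorFunctor (generatedIdeal q C).toRightModule).map φ) :=
    (Presheaf.isLocallyInjective_presheafToSheaf_map_iff
    (J := Opens.grothendieckTopology X)
    (tensorPresheafMap (generatedIdeal q C).toRightModule φ)).2 this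
  exact Sheaf.mono_of_isLocallyInjective _

end Flat

/-! ### Open sets over a given one -/

section Over

variable {X : TopCat.{u}} {U : Opens X}

/-- The morphism of open subsets of `U` given by an inclusion. -/
def overIncl (Y : Over U) {V : Opens X} (hV : V ≤ Y.left) :
    Over.mk (homOfLE hV ≫ Y.hom) ⟶ Y :=
  Over.homMk (homOfLE hV)

/-- Reduces covering sieves on the site of open subsets of `U` to neighbourhoods of points, for
properties of arrows that are stable under precomposition. -/
lemma exists_mem_over (Y : Over U) (p : ∀ ⦃Z : Over U⦄, (Z ⟶ Y) → Prop)
    (hp : ∀ ⦃Z W : Over U⦄ (g : Z ⟶ Y) (h : W ⟶ Z), p g → p (h ≫ g))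
    (h : ∀ x ∈ Y.left, ∃ (V : Opens X) (hV : V ≤ Y.left), x ∈ V ∧ p (overIncl Y hV)) :
    ∃ T ∈ (Opens.grothendieckTopology X).over U Y, ∀ ⦃Z : Over U⦄ (g : Z ⟶ Y), T g → p g := by
  let T : Sieve Y := ⟨fun Z g => p g, fun {Z W g} hg h => hp g h hg⟩
  refine ⟨T, (GrothendieckTopology.mem_over_iff _ _).2 fun x hx => ?_, fun Z g hg => hg⟩
  obtain ⟨V, hV, hxV, hpV⟩ := h x hx
  exact ⟨V, homOfLE hV, (Sieve.overEquiv_iff _ _).2 hpV, hxV⟩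

lemma exists_of_mem_over {Y : Over U} {T : Sieve Y}
    (hT : T ∈ (Opens.grothendieckTopology X).over U Y) {x : X} (hx : x ∈ Y.left) :
    ∃ (V : Opens X) (hV : V ≤ Y.left), x ∈ V ∧ T (overIncl Y hV) := by
  obtain ⟨V, f, hf, hxV⟩ := (GrothendieckTopology.mem_over_iff _ _).1 hT x hx
  exact ⟨V, f.le, hxV, (Sieve.overEquiv_iff _ _).1 hf⟩

end Over

/-! ### Local freeness of the graded pieces -/

section Graded

variable {X : TopCat.{u}} {R S : Sheaf (Opens.grothendieckTopology X) RingCat.{u}}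
  {P : (Opens X)ᵒᵖ ⥤ RingCat.{u}}

/-- Elements over an open set `U`, compatible with restriction, that form a basis of the `p`-th
graded piece of the filtration by powers of the ideal generated by `C`. -/
structure GradedFrame (α' : R.obj ⟶ P) (C : ∀ U : Opens X, Set (P.obj (op U))) (p : ℕ)
    (U : Opens X) where
  I : Type u
  elem (V : Opens X) (hV : V ≤ U) : I → P.obj (op V)
  pres_elem {V W : Opens X} (hV : V ≤ U) (hW : W ≤ V) (i : I) :
    pres P hW (elem V hV i) = elem W (hW.trans hV) i
  elem_mem (V : Opens X) (hV : V ≤ U) (i : I) : elem V hV i ∈ idealPower (C V) p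
  exists_sub_mem (V : Opens X) (hV : V ≤ U) {a : P.obj (op V)} (ha : a ∈ idealPower (C V) p) :
    ∃ f : I →₀ R.obj.obj (op V),
      a - f.sum (fun i r => (α'.app (op V)).hom r * elem V hV i) ∈ idealPower (C V) (p + 1)
  eq_zero (V : Opens X) (hV : V ≤ U) (f : I →₀ R.obj.obj (op V))
    (hf : f.sum (fun i r => (α'.app (op V)).hom r * elem V hV i) ∈ idealPower (C V) (p + 1)) :
    f = 0

namespace GradedFrame

variable {α' : R.obj ⟶ P} {C : ∀ U : Opens X, Set (P.obj (op U))} {p : ℕ} {U : Opens X}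
  (F : GradedFrame α' C p U)

/-- The sum `∑ f i * e i` over `V`. -/
def sum (V : Opens X) (hV : V ≤ U) : (F.I →₀ R.obj.obj (op V)) →+ P.obj (op V) :=
  Finsupp.liftAddHom fun i =>
    (AddMonoidHom.mulRight (F.elem V hV i)).comp (α'.app (op V)).hom.toAddMonoidHom

lemma sum_apply (V : Opens X) (hV : V ≤ U) (f : F.I →₀ R.obj.obj (op V)) :
    F.sum V hV f = f.sum fun i r => (α'.app (op V)).hom r * F.elem V hV i := rfl

lemma sum_single (V : Opens X) (hV : V ≤ U) (i : F.I) (r : R.obj.obj (op V)) :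
    F.sum V hV (Finsupp.single i r) = (α'.app (op V)).hom r * F.elem V hV i :=
  Finsupp.liftAddHom_apply_single _ _ _

lemma pres_sum {V W : Opens X} (hV : V ≤ U) (hW : W ≤ V) (f : F.I →₀ R.obj.obj (op V)) :
    pres P hW (F.sum V hV f) = F.sum W (hW.trans hV) (f.mapRange (res R hW) (map_zero _)) := by
  induction f using Finsupp.induction_linear with
  | zero => simp
  | add f₁ f₂ h₁ h₂ =>
    rw [map_add, map_add, h₁, h₂, Finsupp.mapRange_add (map_add _), map_add]
  | single i r =>
    rw [Finsupp.mapRange_single, sum_single, sum_single, map_mul, F.pres_elem]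
    congr 1
    exact (NatTrans.naturality_apply α' (homOfLE hW).op r).symm

lemma sum_mem (V : Opens X) (hV : V ≤ U) (f : F.I →₀ R.obj.obj (op V)) :
    F.sum V hV f ∈ idealPower (C V) p := by
  induction f using Finsupp.induction_linear with
  | zero => simp
  | add f₁ f₂ h₁ h₂ => rw [map_add]; exact add_mem h₁ h₂
  | single i r =>
    rw [sum_single]
    exact mul_mem_idealPower_left _ (F.elem_mem V hV i)

end GradedFrame

/-! ### Powers of a sheaf of ideals as left modules, and their graded quotients -/

section Module

variable (α : R ⟶ S)

/-- A section of a sheaf of two-sided ideals as a section of the left module. -/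
def leftElem {I : IdealSheaf S} {U : Opens X} (s : S.obj.obj (op U)) (hs : s ∈ I.obj U) :
    (I.toModule α).val.obj (op U) :=
  ⟨s, hs⟩

variable {α}

/-- The section of the ring that underlies a section of the left module. -/
def leftVal {I : IdealSheaf S} {U : Opens X} :
    (I.toModule α).val.obj (op U) →+ S.obj.obj (op U) where
  toFun n := n.1
  map_zero' := rfl
  map_add' _ _ := rfl

lemma leftVal_mem {I : IdealSheaf S} {U : Opens X} (n : (I.toModule α).val.obj (op U)) :
    leftVal n ∈ I.obj U := n.2

lemma leftVal_injective {I : IdealSheaf S} {U : Opens X} :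
    Function.Injective (leftVal (α := α) (I := I) (U := U)) :=
  fun _ _ h => Subtype.ext h

lemma leftVal_leftElem {I : IdealSheaf S} {U : Opens X} {s : S.obj.obj (op U)}
    (hs : s ∈ I.obj U) : leftVal (leftElem α s hs) = s := rfl

lemma leftVal_smul {I : IdealSheaf S} {U : Opens X} (r : R.obj.obj (op U))
    (n : (I.toModule α).val.obj (op U)) :
    leftVal (r • n) = (α.hom.app (op U)).hom r * leftVal n := rfl

lemma leftVal_restrict {I : IdealSheaf S} {U V : Opens X} (h : V ≤ U)
    (n : (I.toModule α).val.obj (op U)) :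
    leftVal ((I.toModule α).val.restrictₛₗ (homOfLE h).op n) = res S h (leftVal n) := rfl

variable (K : IdealSheaf S) (p : ℕ)

instance : Mono (K.powInclusion α p) :=
  (SheafOfModules.forget R).mono_of_mono_map
    (PresheafOfModules.mono_of_injective fun U _ _ h => Subtype.ext
      (congrArg (fun z : ((K.pow p).toModule α).val.obj U => z.1) h))

/-- The projection to the graded piece. -/
def gradedπ (U : Opens X) : ((K.pow p).toModule α).val.obj (op U) →ₗ[R.obj.obj (op U)]
    (K.graded α p).val.obj (op U) :=
  ((cokernel.π (K.powInclusion α p)).val.app (op U)).hom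

lemma gradedπ_restrict {U V : Opens X} (h : V ≤ U) (n : ((K.pow p).toModule α).val.obj (op U)) :
    gradedπ K p V (((K.pow p).toModule α).val.restrictₛₗ (homOfLE h).op n) =
      (K.graded α p).val.restrictₛₗ (homOfLE h).op (gradedπ K p U n) :=
  PresheafOfModules.naturality_apply (cokernel.π (K.powInclusion α p)).val (homOfLE h).op n

lemma gradedπ_eq_zero_iff {U : Opens X} (n : ((K.pow p).toModule α).val.obj (op U)) :
    gradedπ K p U n = 0 ↔ leftVal n ∈ (K.pow (p + 1)).obj U := by
  constructor
  · intro h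
    obtain ⟨m, rfl⟩ := exists_of_cokernel_π_eq_zero (K.powInclusion α p) U n h
    exact m.2
  · intro h
    have : n = (K.powInclusion α p).val.app (op U) (leftElem α _ h) := rfl
    rw [this]
    exact congrArg (fun φ : (K.pow (p + 1)).toModule α ⟶ K.graded α p =>
      φ.val.app (op U) (leftElem α _ h)) (cokernel.condition (K.powInclusion α p))

/-- The quotient is taken in sheaves, so its sections lift to the power of the ideal only locally.
-/
lemma exists_gradedπ_eq {U : Opens X} (s : (K.graded α p).val.obj (op U)) {x : X} (hx : x ∈ U) :
    ∃ (V : Opens X) (hV : V ≤ U), x ∈ V ∧ ∃ n, gradedπ K p V n =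
      (K.graded α p).val.restrictₛₗ (homOfLE hV).op s := by
  obtain ⟨T, hT, h⟩ := locally_mem_range_of_epi (cokernel.π (K.powInclusion α p)) U s
  obtain ⟨V, f, hf, hxV⟩ := hT x hx
  obtain ⟨n, hn⟩ := h f hf
  exact ⟨V, f.le, hxV, n, hn⟩

end Module

/-! ### A frame makes the graded piece free over `U` -/

namespace GradedFrame

variable {α : R ⟶ S} {α' : R.obj ⟶ P} {C : ∀ U : Opens X, Set (P.obj (op U))} {p : ℕ}
  {U : Opens X} (F : GradedFrame α' C p U) {q : P ⟶ S.obj}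
  [Presheaf.IsLocallySurjective (Opens.grothendieckTopology X) q]
  (hC : ∀ {U V : Opens X} (h : V ≤ U), ∀ c ∈ C U, pres P h c ∈ C V)

lemma onSections_mem_pow (hC : ∀ {U V : Opens X} (h : V ≤ U), ∀ c ∈ C U, pres P h c ∈ C V)
    {p : ℕ} {V : Opens X} {t : P.obj (op V)} (ht : t ∈ idealPower (C V) p) :
    onSections q V t ∈ ((generatedIdeal q C).pow p).obj V :=
  (mem_pow_generatedIdeal q C hC).2 fun _ hx => ⟨V, le_rfl, hx, pres P le_rfl t,
    map_mem_idealPower _ (hC _) ht, (res_onSections q le_rfl _).symm⟩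

/-- A combination of frame elements as a section of the power of the ideal. -/
def powElem (α : R ⟶ S) {V : Opens X} (hV : V ≤ U) (f : F.I →₀ R.obj.obj (op V)) :
    (((generatedIdeal q C).pow p).toModule α).val.obj (op V) :=
  leftElem α _ (onSections_mem_pow hC (F.sum_mem V hV f))

/-- The frame elements as sections of the graded piece. -/
def gradedElem (q : P ⟶ S.obj) [Presheaf.IsLocallySurjective (Opens.grothendieckTopology X) q]
    (α : R ⟶ S) {V : Opens X} (hV : V ≤ U) (i : F.I) :
    ((generatedIdeal q C).graded α p).val.obj (op V) :=
  gradedπ _ p V (leftElem α _ (onSections_mem_pow hC (F.elem_mem V hV i)))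

lemma gradedElem_restrict {V W : Opens X} (hV : V ≤ U) (hW : W ≤ V) (i : F.I) :
    ((generatedIdeal q C).graded α p).val.restrictₛₗ (homOfLE hW).op
      (F.gradedElem hC q α hV i) = F.gradedElem hC q α (hW.trans hV) i := by
  rw [gradedElem, ← gradedπ_restrict]
  congr 1
  refine leftVal_injective ?_
  rw [leftVal_restrict, leftVal_leftElem, leftVal_leftElem, res_onSections, F.pres_elem]

/-- By `hα` the scalars act on the ideal through their images in `P`, so applying `q` to a
combination in `P` gives the combination with the same coefficients in the module. -/
lemma gradedπ_powElem (hα : α.hom = α' ≫ q) {V : Opens X} (hV : V ≤ U)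
    (f : F.I →₀ R.obj.obj (op V)) :
    gradedπ _ p V (F.powElem (q := q) hC α hV f) =
      f.sum fun i r => r • F.gradedElem hC q α hV i := by
  have h : F.powElem (q := q) hC α hV f = f.sum fun i r =>
      r • leftElem α _ (onSections_mem_pow (q := q) hC (F.elem_mem V hV i)) := by
    refine leftVal_injective ?_
    rw [powElem, leftVal_leftElem, Finsupp.sum, map_sum, sum_apply, Finsupp.sum, map_sum]
    refine Finset.sum_congr rfl fun i _ => ?_
    rw [leftVal_smul, leftVal_leftElem, map_mul, hα]
    rfl
  rw [h, Finsupp.sum, map_sum]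
  exact Finset.sum_congr rfl fun i _ => map_smul _ _ _

/-- The frame elements as sections of the restriction of the graded piece to `U`. -/
def overSection (q : P ⟶ S.obj) [Presheaf.IsLocallySurjective (Opens.grothendieckTopology X) q]
    (α : R ⟶ S) (i : F.I) : (((generatedIdeal q C).graded α p).over U).sections :=
  ⟨fun Y => F.gradedElem hC q α (leOfHom Y.unop.hom) i, fun f =>
    F.gradedElem_restrict hC _ (leOfHom f.unop.left) i⟩

/-- The morphism from the free sheaf of modules on the frame to the graded piece. -/
def overMap (q : P ⟶ S.obj) [Presheaf.IsLocallySurjective (Opens.grothendieckTopology X) q]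
    (α : R ⟶ S) :
    SheafOfModules.free F.I ⟶ ((generatedIdeal q C).graded α p).over U :=
  (SheafOfModules.freeHomEquiv _).symm (F.overSection hC q α)

/-- Combinations of the generators of the free sheaf of modules. -/
def freeSum (Y : Over U) (f : F.I →₀ (R.over U).obj.obj (op Y)) :
    (SheafOfModules.free (R := R.over U) F.I).val.obj (op Y) :=
  f.sum fun i r => r • sectionAt (SheafOfModules.freeSection (R := R.over U) i) (op Y)

lemma freeSum_zero (Y : Over U) : F.freeSum Y 0 = 0 :=
  Finsupp.sum_zero_index

lemma freeSum_restrict {Y Z : Over U} (g : Z ⟶ Y) (f : F.I →₀ (R.over U).obj.obj (op Y)) :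
    (SheafOfModules.free (R := R.over U) F.I).val.restrictₛₗ g.op (F.freeSum Y f) =
      F.freeSum Z (f.mapRange (res R (leOfHom g.left)) (map_zero _)) := by
  refine Eq.trans ?_ (Finsupp.sum_mapRange_index
    (h := fun i r => r • sectionAt (SheafOfModules.freeSection (R := R.over U) i) (op Z))
    fun i => zero_smul _ _).symm
  rw [freeSum, Finsupp.sum, map_sum]
  refine Finset.sum_congr rfl fun i _ => ?_
  rw [map_smulₛₗ, sectionAt_map]
  rfl

lemma overMap_freeSum (hα : α.hom = α' ≫ q) (Y : Over U) (f : F.I →₀ (R.over U).obj.obj (op Y)) :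
    (F.overMap hC q α).val.app (op Y) (F.freeSum Y f) =
      gradedπ _ p Y.left (F.powElem (q := q) hC α (leOfHom Y.hom) f) := by
  refine Eq.trans ?_ (F.gradedπ_powElem hC hα (leOfHom Y.hom) f).symm
  refine (map_sum ((F.overMap hC q α).val.app (op Y)).hom _ _).trans ?_
  refine Finset.sum_congr rfl fun i _ => ?_
  refine (((F.overMap hC q α).val.app (op Y)).hom.map_smul _ _).trans ?_
  have h := congrArg (fun s => sectionAt s (op Y))
    (SheafOfModules.sectionsMap_freeHomEquiv_symm_freeSection (F.overSection hC q α) i)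
  exact congrArg (fun z => (show R.obj.obj (op Y.left) from f i) • (show
    ((generatedIdeal q C).graded α p).val.obj (op Y.left) from z)) h

lemma exists_freeSum_eq {Y : Over U} (s : (SheafOfModules.free (R := R.over U) F.I).val.obj (op Y))
    {x : X} (hx : x ∈ Y.left) : ∃ (V : Opens X) (hV : V ≤ Y.left), x ∈ V ∧
      ∃ f, F.freeSum (Over.mk (homOfLE hV ≫ Y.hom)) f =
        (SheafOfModules.free (R := R.over U) F.I).val.restrictₛₗ (overIncl Y hV).op s := by
  obtain ⟨T, hT, h⟩ := free_locally_span (R := R.over U) Y s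
  obtain ⟨V, hV, hxV, hVT⟩ := exists_of_mem_over hT hx
  exact ⟨V, hV, hxV, Finsupp.mem_span_range_iff_exists_finsupp.1 (h _ hVT)⟩

/-- Sections of the free sheaf are locally combinations of generators, so injectivity reduces to
independence modulo the next power (`eq_zero`). Sections of the graded piece lift locally to the
power computed in `P`, so surjectivity reduces to `exists_sub_mem`. -/
lemma isIso_overMap (hα : α.hom = α' ≫ q)
    [Presheaf.IsLocallyInjective (Opens.grothendieckTopology X) q] :
    IsIso (F.overMap hC q α) := by
  refine isIso_of_injective_of_locally_surjective _ (fun Y => ?_) (fun Y s => ?_)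
  · refine (injective_iff_map_eq_zero ((F.overMap hC q α).val.app (op Y)).hom).2 fun s hs => ?_
    obtain ⟨T, hT, h⟩ := exists_mem_over Y
      (fun Z g => (SheafOfModules.free (R := R.over U) F.I).val.restrictₛₗ g.op s = 0)
      (fun Z W g h hg => by rw [op_comp, restrict_comp, hg, map_zero]) fun x hx => by
        obtain ⟨V, hV, hxV, f, hf⟩ := F.exists_freeSum_eq s hx
        have h₁ : gradedπ _ p V (F.powElem (q := q) hC α (hV.trans (leOfHom Y.hom)) f) = 0 := by
          refine (F.overMap_freeSum hC hα (Over.mk (homOfLE hV ≫ Y.hom)) f).symm.trans ?_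
          rw [hf]
          refine (PresheafOfModules.naturality_apply (F.overMap hC q α).val
            (overIncl Y hV).op s).trans ?_
          rw [show (F.overMap hC q α).val.app (op Y) s = 0 from hs]
          exact map_zero ((((generatedIdeal q C).graded α p).over U).val.restrictₛₗ _)
        rw [gradedπ_eq_zero_iff, mem_pow_generatedIdeal q C hC] at h₁
        obtain ⟨W, hW, hxW, t, ht, hts⟩ := h₁ x hxV
        -- The element `t` of the next power and the combination of frame elements have the same
        -- image under `q`, so they coincide in `P` after one more shrinking.
        obtain ⟨W', hW', hxW', e⟩ := exists_local_eq q
          (hts.trans (res_onSections q hW (F.sum V (hV.trans (leOfHom Y.hom)) f))) hxW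
        refine ⟨W', (hW'.trans hW).trans hV, hxW', ?_⟩
        have h₂ := F.eq_zero W' ((hW'.trans hW).trans (hV.trans (leOfHom Y.hom)))
          (f.mapRange (res R (hW'.trans hW)) (map_zero _)) (Set.mem_of_eq_of_mem
            ((F.pres_sum (hV.trans (leOfHom Y.hom)) (hW'.trans hW) f).symm.trans
              ((pres_pres P hW hW' _).symm.trans e.symm))
            (map_mem_idealPower _ (hC _) ht))
        let g : Over.mk (homOfLE ((hW'.trans hW).trans hV) ≫ Y.hom) ⟶
          Over.mk (homOfLE hV ≫ Y.hom) := Over.homMk (homOfLE (hW'.trans hW))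
        have hg : overIncl Y ((hW'.trans hW).trans hV) = g ≫ overIncl Y hV := rfl
        rw [hg, op_comp, restrict_comp, ← hf, F.freeSum_restrict]
        exact (congrArg (F.freeSum _) h₂).trans (F.freeSum_zero _)
    refine eq_of_locally_eq _ hT fun Z g hg => ?_
    rw [h g hg, map_zero]
  · refine exists_mem_over Y (fun Z g => ∃ a, (F.overMap hC q α).val.app (op Z) a =
      (((generatedIdeal q C).graded α p).over U).val.restrictₛₗ g.op s) ?_ fun x hx => ?_
    · rintro Z W g h ⟨a, ha⟩
      refine ⟨(SheafOfModules.free F.I).val.restrictₛₗ h.op a, ?_⟩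
      rw [op_comp, restrict_comp, ← ha]
      exact PresheafOfModules.naturality_apply (F.overMap hC q α).val h.op a
    · obtain ⟨V, hV, hxV, n, hn⟩ := exists_gradedπ_eq (generatedIdeal q C) p
        (U := Y.left) s hx
      obtain ⟨W, hW, hxW, t, ht, hts⟩ := (mem_pow_generatedIdeal q C hC).1 (leftVal_mem n) x hxV
      obtain ⟨f, hf⟩ := F.exists_sub_mem W ((hW.trans hV).trans (leOfHom Y.hom)) ht
      refine ⟨W, hW.trans hV, hxW, F.freeSum (Over.mk (homOfLE (hW.trans hV) ≫ Y.hom)) f, ?_⟩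
      refine (F.overMap_freeSum hC hα (Over.mk (homOfLE (hW.trans hV) ≫ Y.hom)) f).trans ?_
      -- The lift and the combination of frame elements differ by a section of the next power, which
      -- the quotient kills.
      have h₁ : gradedπ _ p W ((((generatedIdeal q C).pow p).toModule α).val.restrictₛₗ
          (homOfLE hW).op n - F.powElem (q := q) hC α ((hW.trans hV).trans (leOfHom Y.hom)) f)
            = 0 := by
        rw [gradedπ_eq_zero_iff, map_sub, leftVal_restrict, ← hts, powElem, leftVal_leftElem,
          ← map_sub]
        exact onSections_mem_pow hC hf
      rw [map_sub, sub_eq_zero] at h₁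
      refine h₁.symm.trans ((gradedπ_restrict _ _ hW n).trans ?_)
      rw [hn]
      exact (restrict_comp ((generatedIdeal q C).graded α p).val _ _ _).symm

end GradedFrame

/-- If the graded pieces of the ideals generated by `C` are locally free, then so are those of the
sheaf of ideals generated by `C`. -/
theorem isLocallyFree_graded_of_frames {α : R ⟶ S} {α' : R.obj ⟶ P} {q : P ⟶ S.obj}
    (hα : α.hom = α' ≫ q) [Presheaf.IsLocallyInjective (Opens.grothendieckTopology X) q]
    [Presheaf.IsLocallySurjective (Opens.grothendieckTopology X) q]
    (C : ∀ U : Opens X, Set (P.obj (op U)))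
    (hC : ∀ {U V : Opens X} (h : V ≤ U), ∀ c ∈ C U, pres P h c ∈ C V) (p : ℕ)
    (hF : ∀ x : X, ∃ U : Opens X, x ∈ U ∧ Nonempty (GradedFrame α' C p U)) :
    ((generatedIdeal q C).graded α p).IsLocallyFree := by
  choose U hxU hF using hF
  let F (x : X) : GradedFrame α' C p (U x) := (hF x).some
  have hiso (x : X) : IsIso ((F x).overMap hC q α) := (F x).isIso_overMap hC hα
  let D : ((generatedIdeal q C).graded α p).LocalGeneratorsData :=
    { I := X
      X := U
      coversTop := (Opens.coversTop_iff X U).2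
        (eq_top_iff.2 fun x _ => Opens.mem_iSup.2 ⟨x, hxU x⟩)
      generators := fun x =>
        { I := (F x).I
          s := (F x).overSection hC q α
          epi := inferInstanceAs (Epi ((F x).overMap hC q α)) } }
  have : D.IsLocallyFreeData :=
    SheafOfModules.LocalGeneratorsData.IsLocallyFreeData.mk (q := D) hiso
  exact D.isLocallyFree

end Graded

/-- The commutator is bilinear over the central scalars, so basis vectors suffice. This is the
spanning hypothesis on `C` in the results on normal words. -/
lemma commutator_mem_span {R M M₁ M₂ ι₁ ι₂ : Type u} [CommRing R] [AddCommGroup M] [Module R M]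
    [AddCommGroup M₁] [Module R M₁] [AddCommGroup M₂] [Module R M₂]
    (b : Module.Basis (ι₁ ⊕ ι₂) R M) (b₁ : Module.Basis ι₁ R M₁) (b₂ : Module.Basis ι₂ R M₂)
    (f : M₁ →ₗ[R] M) (g : M₂ →ₗ[R] M) (hf : ∀ i, b (Sum.inl i) = f (b₁ i))
    (hg : ∀ j, b (Sum.inr j) = g (b₂ j)) (m₁ : M₁) (m₂ : M₂) :
    TensorAlgebra.ι R (f m₁) * TensorAlgebra.ι R (g m₂) -
        TensorAlgebra.ι R (g m₂) * TensorAlgebra.ι R (f m₁) ∈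
      Submodule.span R (Set.range (comm (letterX b) (letterY b))) := by
  induction b₁.mem_span m₁ using Submodule.span_induction with
  | zero => simp
  | add a c _ _ ha hc =>
    rw [map_add, map_add, add_mul, mul_add, add_sub_add_comm]
    exact add_mem ha hc
  | smul r a _ ha =>
    rw [map_smul, map_smul, smul_mul_assoc, mul_smul_comm, ← smul_sub]
    exact Submodule.smul_mem _ r ha
  | mem a ha =>
    obtain ⟨i, rfl⟩ := ha
    induction b₂.mem_span m₂ using Submodule.span_induction with
    | zero => simp
    | add a c _ _ ha hc =>
      rw [map_add, map_add, add_mul, mul_add, add_sub_add_comm]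
      exact add_mem ha hc
    | smul r a _ ha =>
      rw [map_smul, map_smul, smul_mul_assoc, mul_smul_comm, ← smul_sub]
      exact Submodule.smul_mem _ r ha
    | mem a ha =>
      obtain ⟨j, rfl⟩ := ha
      refine Submodule.subset_span ⟨(i, j), ?_⟩
      simp only [comm, letterX, letterY, hf, hg]

/-! ### The doubled Jordan quiver -/

section Jordan

variable {X : RingedSpace.{u, u}}

instance (M : SheafOfModules.{u} (structureSheaf X)) (V : (Opens X.carrier)ᵒᵖ) :
    Module (X.presheaf.obj V) (M.val.obj V) :=
  inferInstanceAs (Module ((structureSheaf X).obj.obj V) (M.val.obj V))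

/-- Sections of a sheaf of modules over an open set that restrict to bases of the modules of
sections over all smaller open sets. -/
structure LocalBasis (M : SheafOfModules.{u} (structureSheaf X)) (U : Opens X.carrier) where
  I : Type u
  basis (V : Opens X.carrier) (hV : V ≤ U) :
    Module.Basis I (X.presheaf.obj (op V)) (M.val.obj (op V))
  restrict_basis {V W : Opens X.carrier} (hV : V ≤ U) (hW : W ≤ V) (i : I) :
    M.val.restrictₛₗ (homOfLE hW).op (basis V hV i) = basis W (hW.trans hV) i

/-- Finite rank enters here: by `exists_basis_of_isIso` a finite free generating family gives a
basis of sections over every smaller open set. -/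
lemma exists_localBasis {M : SheafOfModules.{u} (structureSheaf X)}
    (hM : IsLocallyFreeOfFiniteRank M) (x : X.carrier) :
    ∃ U : Opens X.carrier, x ∈ U ∧ Nonempty (LocalBasis M U) := by
  obtain ⟨q, hq, hq'⟩ := hM
  obtain ⟨i, hi⟩ := Opens.mem_iSup.1
    ((((Opens.coversTop_iff X.carrier q.X).1 q.coversTop).iSup_eq_top ▸ Opens.mem_top x :
      x ∈ iSup q.X))
  have := hq.isIso i
  have := (hq'.isFiniteType i).finite
  choose b hb using exists_basis_of_isIso (q.generators i)
  refine ⟨q.X i, hi, ⟨⟨(q.generators i).I, fun V hV => b (op (Over.mk (homOfLE hV))), ?_⟩⟩⟩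
  intro V W hV hW k
  have h := sectionAt_map ((q.generators i).s k)
    (Over.homMk (homOfLE hW) : Over.mk (homOfLE (hW.trans hV)) ⟶ Over.mk (homOfLE hV)).op
  rw [← hb, ← hb] at h
  exact h

/-- A local basis restricted to a smaller open set. -/
def LocalBasis.restrict {M : SheafOfModules.{u} (structureSheaf X)} {U U' : Opens X.carrier}
    (B : LocalBasis M U) (h : U' ≤ U) : LocalBasis M U' where
  I := B.I
  basis V hV := B.basis V (hV.trans h)
  restrict_basis hV hW i := B.restrict_basis (hV.trans h) hW i

variable (M₁ M₂ : SheafOfModules.{u} (structureSheaf X))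

/-- The map `M₁(V) → (M₁ ⊕ M₂)(V)`. -/
def inlAt (V : Opens X.carrier) :
    M₁.val.obj (op V) →ₗ[X.presheaf.obj (op V)] (M₁ ⊞ M₂).val.obj (op V) :=
  ((biprod.inl : M₁ ⟶ M₁ ⊞ M₂).val.app (op V)).hom

/-- The map `M₂(V) → (M₁ ⊕ M₂)(V)`. -/
def inrAt (V : Opens X.carrier) :
    M₂.val.obj (op V) →ₗ[X.presheaf.obj (op V)] (M₁ ⊞ M₂).val.obj (op V) :=
  ((biprod.inr : M₂ ⟶ M₁ ⊞ M₂).val.app (op V)).hom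

lemma restrict_inlAt {V W : Opens X.carrier} (h : W ≤ V) (m : M₁.val.obj (op V)) :
    (M₁ ⊞ M₂).val.restrictₛₗ (homOfLE h).op (inlAt M₁ M₂ V m) =
      inlAt M₁ M₂ W (M₁.val.restrictₛₗ (homOfLE h).op m) :=
  (PresheafOfModules.naturality_apply (biprod.inl : M₁ ⟶ M₁ ⊞ M₂).val (homOfLE h).op m).symm

lemma restrict_inrAt {V W : Opens X.carrier} (h : W ≤ V) (m : M₂.val.obj (op V)) :
    (M₁ ⊞ M₂).val.restrictₛₗ (homOfLE h).op (inrAt M₁ M₂ V m) =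
      inrAt M₁ M₂ W (M₂.val.restrictₛₗ (homOfLE h).op m) :=
  (PresheafOfModules.naturality_apply (biprod.inr : M₂ ⟶ M₁ ⊞ M₂).val (homOfLE h).op m).symm

/-- Sections of a direct sum are pairs of sections. -/
def sectionsBiprod (V : Opens X.carrier) :
    (M₁.val.obj (op V) × M₂.val.obj (op V)) ≃ₗ[X.presheaf.obj (op V)]
      (M₁ ⊞ M₂).val.obj (op V) :=
  LinearEquiv.ofLinearMap ((inlAt M₁ M₂ V).coprod (inrAt M₁ M₂ V))
    (LinearMap.prod
      (show (M₁ ⊞ M₂).val.obj (op V) →ₗ[X.presheaf.obj (op V)] M₁.val.obj (op V) from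
        ((biprod.fst : M₁ ⊞ M₂ ⟶ M₁).val.app (op V)).hom)
      (show (M₁ ⊞ M₂).val.obj (op V) →ₗ[X.presheaf.obj (op V)] M₂.val.obj (op V) from
        ((biprod.snd : M₁ ⊞ M₂ ⟶ M₂).val.app (op V)).hom))
    (LinearMap.ext fun m =>
      congrArg (fun φ : M₁ ⊞ M₂ ⟶ M₁ ⊞ M₂ => φ.val.app (op V) m) (biprod.total (X := M₁) (Y := M₂)))
    (by
      have h₁ (m : M₁.val.obj (op V)) :
          (biprod.fst : M₁ ⊞ M₂ ⟶ M₁).val.app (op V) (inlAt M₁ M₂ V m) = m :=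
        congrArg (fun φ : M₁ ⟶ M₁ => φ.val.app (op V) m) (biprod.inl_fst (X := M₁) (Y := M₂))
      have h₂ (m : M₁.val.obj (op V)) :
          (biprod.snd : M₁ ⊞ M₂ ⟶ M₂).val.app (op V) (inlAt M₁ M₂ V m) = 0 :=
        congrArg (fun φ : M₁ ⟶ M₂ => φ.val.app (op V) m) (biprod.inl_snd (X := M₁) (Y := M₂))
      have h₃ (m : M₂.val.obj (op V)) :
          (biprod.fst : M₁ ⊞ M₂ ⟶ M₁).val.app (op V) (inrAt M₁ M₂ V m) = 0 :=
        congrArg (fun φ : M₂ ⟶ M₁ => φ.val.app (op V) m) (biprod.inr_fst (X := M₁) (Y := M₂))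
      have h₄ (m : M₂.val.obj (op V)) :
          (biprod.snd : M₁ ⊞ M₂ ⟶ M₂).val.app (op V) (inrAt M₁ M₂ V m) = m :=
        congrArg (fun φ : M₂ ⟶ M₂ => φ.val.app (op V) m) (biprod.inr_snd (X := M₁) (Y := M₂))
      refine LinearMap.prod_ext ?_ ?_
      · rw [LinearMap.comp_assoc, LinearMap.coprod_inl, LinearMap.id_comp]
        exact LinearMap.ext fun m => Prod.ext (h₁ m) (h₂ m)
      · rw [LinearMap.comp_assoc, LinearMap.coprod_inr, LinearMap.id_comp]
        exact LinearMap.ext fun m => Prod.ext (h₃ m) (h₄ m))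

section Frame

variable {M₁ M₂} {U : Opens X.carrier} (B₁ : LocalBasis M₁ U) (B₂ : LocalBasis M₂ U)

/-- The basis of `(M₁ ⊕ M₂)(V)` given by local bases of `M₁` and `M₂`. -/
def sumBasis (V : Opens X.carrier) (hV : V ≤ U) :
    Module.Basis (B₁.I ⊕ B₂.I) (X.presheaf.obj (op V)) ((M₁ ⊞ M₂).val.obj (op V)) :=
  ((B₁.basis V hV).prod (B₂.basis V hV)).map (sectionsBiprod M₁ M₂ V)

lemma sumBasis_inl (V : Opens X.carrier) (hV : V ≤ U) (i : B₁.I) :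
    sumBasis B₁ B₂ V hV (Sum.inl i) = inlAt M₁ M₂ V (B₁.basis V hV i) := by
  simp [sumBasis, sectionsBiprod]

lemma sumBasis_inr (V : Opens X.carrier) (hV : V ≤ U) (j : B₂.I) :
    sumBasis B₁ B₂ V hV (Sum.inr j) = inrAt M₁ M₂ V (B₂.basis V hV j) := by
  simp [sumBasis, sectionsBiprod]

end Frame

/-- The presheaf of tensor algebras whose associated sheaf is the twisted quiver algebra. -/
abbrev jordanPresheaf : (Opens X.carrier)ᵒᵖ ⥤ RingCat.{u} :=
  tensorAlgebraPresheaf (O := X.presheaf) (M₁ ⊞ M₂).val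

/-- The commutators in the tensor algebra of the sections over `V`. -/
def commutators (V : Opens X.carrier) : Set ((jordanPresheaf M₁ M₂).obj (op V)) :=
  {c : TensorAlgebra (X.presheaf.obj (op V)) ((M₁ ⊞ M₂).val.obj (op V)) |
    ∃ (m₁ : M₁.val.obj (op V)) (m₂ : M₂.val.obj (op V)),
      c = TensorAlgebra.ι _ (inlAt M₁ M₂ V m₁) * TensorAlgebra.ι _ (inrAt M₁ M₂ V m₂) -
        TensorAlgebra.ι _ (inrAt M₁ M₂ V m₂) * TensorAlgebra.ι _ (inlAt M₁ M₂ V m₁)}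

lemma pres_jordan_ι {V W : Opens X.carrier} (h : W ≤ V) (m : (M₁ ⊞ M₂).val.obj (op V)) :
    pres (jordanPresheaf M₁ M₂) h (TensorAlgebra.ι (X.presheaf.obj (op V)) m) =
      TensorAlgebra.ι (X.presheaf.obj (op W)) ((M₁ ⊞ M₂).val.restrictₛₗ (homOfLE h).op m) :=
  tensorAlgebraMap_ι _ _ m

lemma pres_mem_commutators {V W : Opens X.carrier} (h : W ≤ V) (c)
    (hc : c ∈ commutators M₁ M₂ V) : pres (jordanPresheaf M₁ M₂) h c ∈ commutators M₁ M₂ W := by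
  obtain ⟨m₁, m₂, rfl⟩ := hc
  refine ⟨M₁.val.restrictₛₗ (homOfLE h).op m₁, M₂.val.restrictₛₗ (homOfLE h).op m₂, ?_⟩
  rw [← restrict_inlAt, ← restrict_inrAt, ← pres_jordan_ι, ← pres_jordan_ι]
  exact (map_sub _ _ _).trans (congrArg₂ _ (map_mul _ _ _) (map_mul _ _ _))

/-- The map from the presheaf of tensor algebras to the twisted quiver algebra. -/
abbrev toJordan : jordanPresheaf M₁ M₂ ⟶ (jordanAlgebra M₁ M₂).obj :=
  toSheafify (Opens.grothendieckTopology X.carrier) (jordanPresheaf M₁ M₂)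

/-- The map to the associated sheaf is a ring homomorphism on sections, so it carries commutators in
the presheaf of tensor algebras to the generators of the ideal. -/
lemma commutatorIdeal_eq :
    commutatorIdeal M₁ M₂ = generatedIdeal (toJordan M₁ M₂) (commutators M₁ M₂) := by
  refine congrArg IdealSheaf.generate (funext fun V => Set.ext fun s => ⟨?_, ?_⟩)
  · rintro ⟨m₁, m₂, rfl⟩
    refine ⟨_, ⟨m₁, m₂, rfl⟩, ?_⟩
    exact (map_sub _ _ _).trans (congrArg₂ _ (map_mul _ _ _) (map_mul _ _ _))
  · rintro ⟨_, ⟨m₁, m₂, rfl⟩, rfl⟩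
    refine ⟨m₁, m₂, ?_⟩
    exact (map_sub _ _ _).trans (congrArg₂ _ (map_mul _ _ _) (map_mul _ _ _))

section Frame

variable {M₁ M₂} {U : Opens X.carrier} (B₁ : LocalBasis M₁ U) (B₂ : LocalBasis M₂ U)

lemma restrict_sumBasis_inl {V W : Opens X.carrier} (hV : V ≤ U) (hW : W ≤ V) (i : B₁.I) :
    (M₁ ⊞ M₂).val.restrictₛₗ (homOfLE hW).op (sumBasis B₁ B₂ V hV (Sum.inl i)) =
      sumBasis B₁ B₂ W (hW.trans hV) (Sum.inl i) := by
  rw [sumBasis_inl, sumBasis_inl, ← B₁.restrict_basis hV hW]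
  exact restrict_inlAt M₁ M₂ hW _

lemma pres_letterX {V W : Opens X.carrier} (hV : V ≤ U) (hW : W ≤ V) (i : B₁.I) :
    pres (jordanPresheaf M₁ M₂) hW (letterX (sumBasis B₁ B₂ V hV) i) =
      letterX (sumBasis B₁ B₂ W (hW.trans hV)) i :=
  (pres_jordan_ι M₁ M₂ hW _).trans
    (congrArg (TensorAlgebra.ι (X.presheaf.obj (op W))) (restrict_sumBasis_inl B₁ B₂ hV hW i))

lemma restrict_sumBasis_inr {V W : Opens X.carrier} (hV : V ≤ U) (hW : W ≤ V) (j : B₂.I) :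
    (M₁ ⊞ M₂).val.restrictₛₗ (homOfLE hW).op (sumBasis B₁ B₂ V hV (Sum.inr j)) =
      sumBasis B₁ B₂ W (hW.trans hV) (Sum.inr j) := by
  rw [sumBasis_inr, sumBasis_inr, ← B₂.restrict_basis hV hW]
  exact restrict_inrAt M₁ M₂ hW _

lemma pres_letterY {V W : Opens X.carrier} (hV : V ≤ U) (hW : W ≤ V) (j : B₂.I) :
    pres (jordanPresheaf M₁ M₂) hW (letterY (sumBasis B₁ B₂ V hV) j) =
      letterY (sumBasis B₁ B₂ W (hW.trans hV)) j :=
  (pres_jordan_ι M₁ M₂ hW _).trans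
    (congrArg (TensorAlgebra.ι (X.presheaf.obj (op W))) (restrict_sumBasis_inr B₁ B₂ hV hW j))

lemma comm_mem_commutators (V : Opens X.carrier) (hV : V ≤ U) (c : B₁.I × B₂.I) :
    comm (letterX (sumBasis B₁ B₂ V hV)) (letterY (sumBasis B₁ B₂ V hV)) c ∈
      commutators M₁ M₂ V := by
  refine ⟨B₁.basis V hV c.1, B₂.basis V hV c.2, ?_⟩
  rw [← sumBasis_inl B₁ B₂, ← sumBasis_inr B₁ B₂]
  rfl

lemma commutators_subset_span (V : Opens X.carrier) (hV : V ≤ U) :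
    commutators M₁ M₂ V ⊆ (Submodule.span (X.presheaf.obj (op V)) (Set.range
      (comm (letterX (sumBasis B₁ B₂ V hV)) (letterY (sumBasis B₁ B₂ V hV)))) :
        Set (TensorAlgebra (X.presheaf.obj (op V)) ((M₁ ⊞ M₂).val.obj (op V)))) := by
  rintro _ ⟨m₁, m₂, rfl⟩
  exact commutator_mem_span _ (B₁.basis V hV) (B₂.basis V hV) (inlAt M₁ M₂ V) (inrAt M₁ M₂ V)
    (sumBasis_inl B₁ B₂ V hV) (sumBasis_inr B₁ B₂ V hV) m₁ m₂

/-- The letters given by local bases of `M₁` and `M₂`. -/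
def jordanFrame : Frame (jordanPresheaf M₁ M₂) (commutators M₁ M₂) U where
  ι₁ := B₁.I
  ι₂ := B₂.I
  x V hV := letterX (sumBasis B₁ B₂ V hV)
  y V hV := letterY (sumBasis B₁ B₂ V hV)
  pres_x := pres_letterX B₁ B₂
  pres_y := pres_letterY B₁ B₂
  comm_mem := comm_mem_commutators B₁ B₂
  blockSum_injective V hV := blockSum_injective (sumBasis B₁ B₂ V hV)
  exists_blockSum_eq V hV _ ha :=
    exists_blockSum_eq (sumBasis B₁ B₂ V hV) (commutators_subset_span B₁ B₂ V hV) ha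

/-- The normal words with `p` commutators given by local bases of `M₁` and `M₂`. -/
def jordanGradedFrame (p : ℕ) :
    GradedFrame (R := structureSheaf X) (tensorAlgebraPresheafUnit (O := X.presheaf) (M₁ ⊞ M₂).val)
      (commutators M₁ M₂) p U where
  I := {w : NormalWord B₁.I B₂.I // w.1.length = p}
  elem V hV w := NormalWord.eval (letterX (sumBasis B₁ B₂ V hV)) (letterY (sumBasis B₁ B₂ V hV)) w.1
  pres_elem {V W} hV hW w := by
    refine (NormalWord.map_eval _ _ (pres (jordanPresheaf M₁ M₂) hW) w.1).trans ?_
    congr 1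
    · exact funext (pres_letterX B₁ B₂ hV hW)
    · exact funext (pres_letterY B₁ B₂ hV hW)
  elem_mem V hV w := by
    have := NormalWord.eval_mem_idealPower _ _ (comm_mem_commutators B₁ B₂ V hV) w.1
    rwa [w.2] at this
  exists_sub_mem V hV a ha := by
    obtain ⟨f, hf⟩ := sub_sum_mem_idealPower_succ (sumBasis B₁ B₂ V hV)
      (comm_mem_commutators B₁ B₂ V hV) (commutators_subset_span B₁ B₂ V hV) ha
    -- In a graded frame the scalars act as left multiplication by their images under the unit map,
    -- which here is `algebraMap`.
    simp only [Algebra.smul_def] at hf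
    exact ⟨f, hf⟩
  eq_zero V hV f hf := by
    refine eq_zero_of_sum_mem_idealPower_succ (sumBasis B₁ B₂ V hV)
      (commutators_subset_span B₁ B₂ V hV) (p := p) (f := f) ?_
    simp only [Algebra.smul_def]
    exact hf

end Frame

lemma exists_localBasis_pair (h₁ : IsLocallyFreeOfFiniteRank M₁)
    (h₂ : IsLocallyFreeOfFiniteRank M₂) (x : X.carrier) : ∃ U : Opens X.carrier, x ∈ U ∧
      Nonempty (LocalBasis M₁ U) ∧ Nonempty (LocalBasis M₂ U) := by
  obtain ⟨U₁, hx₁, ⟨B₁⟩⟩ := exists_localBasis h₁ x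
  obtain ⟨U₂, hx₂, ⟨B₂⟩⟩ := exists_localBasis h₂ x
  exact ⟨U₁ ⊓ U₂, ⟨hx₁, hx₂⟩, ⟨B₁.restrict inf_le_left⟩, ⟨B₂.restrict inf_le_right⟩⟩

instance : Presheaf.IsLocallyInjective (Opens.grothendieckTopology X.carrier)
    (toJordan M₁ M₂) :=
  Presheaf.isLocallyInjective_toSheafify' _ _

instance : Presheaf.IsLocallySurjective (Opens.grothendieckTopology X.carrier)
    (toJordan M₁ M₂) :=
  Presheaf.isLocallySurjective_toSheafify' _ _

lemma jordanUnit_hom : (jordanUnit M₁ M₂).hom =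
    tensorAlgebraPresheafUnit (O := X.presheaf) (M₁ ⊞ M₂).val ≫ toJordan M₁ M₂ := rfl

lemma isLocallyFree_graded_toJordan (p : ℕ)
    (hF : ∀ x : X.carrier, ∃ U : Opens X.carrier, x ∈ U ∧ Nonempty
      (GradedFrame (R := structureSheaf X) (tensorAlgebraPresheafUnit (O := X.presheaf)
        (M₁ ⊞ M₂).val) (commutators M₁ M₂) p U)) :
    ((generatedIdeal (toJordan M₁ M₂) (commutators M₁ M₂)).graded
      (jordanUnit M₁ M₂) p).IsLocallyFree :=
  isLocallyFree_graded_of_frames (S := jordanAlgebra M₁ M₂) (α := jordanUnit M₁ M₂)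
    (q := toJordan M₁ M₂) (jordanUnit_hom M₁ M₂) (commutators M₁ M₂)
    (pres_mem_commutators M₁ M₂) p hF

lemma isFlatRight_toJordan
    (hF : ∀ x : X.carrier, ∃ U : Opens X.carrier, x ∈ U ∧ Nonempty
      (Frame (jordanPresheaf M₁ M₂) (commutators M₁ M₂) U)) :
    IsFlatRight (generatedIdeal (toJordan M₁ M₂) (commutators M₁ M₂)).toRightModule :=
  isFlatRight_of_frames (S := jordanAlgebra M₁ M₂) (toJordan M₁ M₂) (commutators M₁ M₂)
    (pres_mem_commutators M₁ M₂) hF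

end Jordan

end TwistedQuiver

end

theorem mainTheorem9 {𝕜 : Type*} [Field 𝕜] (X : RingedSpace.{u, u})
    (structureMap : 𝕜 →+* X.presheaf.obj (op ⊤))
    (M₁ M₂ : SheafOfModules.{u} (TwistedQuiver.structureSheaf X))
    (h₁ : TwistedQuiver.IsLocallyFreeOfFiniteRank M₁)
    (h₂ : TwistedQuiver.IsLocallyFreeOfFiniteRank M₂) :
    (∀ p : ℕ, ((TwistedQuiver.commutatorIdeal M₁ M₂).graded
        (TwistedQuiver.jordanUnit M₁ M₂) p).IsLocallyFree) ∧
      TwistedQuiver.IsFlatRight (TwistedQuiver.commutatorIdeal M₁ M₂).toRightModule := by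
  -- Every point has a neighbourhood over which both twists have bases, and these bases provide the
  -- frames for both claims.
  have hB := TwistedQuiver.exists_localBasis_pair M₁ M₂ h₁ h₂
  rw [TwistedQuiver.commutatorIdeal_eq]
  refine ⟨fun p => ?_, ?_⟩
  · refine TwistedQuiver.isLocallyFree_graded_toJordan M₁ M₂ p fun x => ?_
    obtain ⟨U, hx, ⟨B₁⟩, ⟨B₂⟩⟩ := hB x
    exact ⟨U, hx, ⟨TwistedQuiver.jordanGradedFrame B₁ B₂ p⟩⟩
  · refine TwistedQuiver.isFlatRight_toJordan M₁ M₂ fun x => ?_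
    obtain ⟨U, hx, ⟨B₁⟩, ⟨B₂⟩⟩ := hB x
    exact ⟨U, hx, ⟨TwistedQuiver.jordanFrame B₁ B₂⟩⟩
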